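/- **Theorem (MMSE in multi-branch sampling).** Let $P\ge 1$ be an integer and $f_s>0$. Let $X(\cdot)=\{X(t),\,t\in\mathbb R\}$ be a real, centered, measurable stationary Gaussian process with power spectral density $S_X\ge 0$, $S_X\in L^1(\mathbb R)$, i.e. $\mathbb E[X(t)X(s)]=\int_{\mathbb R}S_X(f)e^{2\pi i(t-s)f}\,df$, and let $\sigma_X^2=\mathbb E[X(t)^2]=\int_{\mathbb R} S_X(f)\,df$. Let $\eta(\cdot)$ be a real, centered stationary Gaussian noise, independent of $X(\cdot)$, with measurable power spectral density $S_\eta\ge 0$; $S_\eta$ need not be integrable (e.g. white noise), in which case $\eta$ is a generalized process, given by its values $\eta(\varphi)$ on those real Schwartz functions $\varphi$ for which $\int_{\mathbb R}|\hat\varphi(f)|^2S_\eta(f)\,df<\infty$, with $\mathbb E[\eta(\varphi)\eta(\psi)]=\int_{\mathbb R}\hat\varphi(f)^*\,\hat\psi(f)\,S_\eta(f)\,df$, where ${}^*$ is the complex conjugate (the conjugate transpose, for matrices). Put $S_{X+\eta}=S_X+S_\eta$. For $p=1,\dots,P$ let $H_p:\mathbb R\to\mathbb C$ be the measurable frequency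 response of a linear time-invariant system with real impulse response $h_p$ (so $H_p(-f)=H_p(f)^*$), such that $$\int_{\mathbb R}S_{X+\eta}(f)\,|H_p(f)|^2\,df<\infty ,$$ let $Z_p=h_p\star(X+\eta)$ be its response to the noisy source (defined through the mean-square isometry in which $X(t)$ corresponds to $e^{2\pi i t f}$ in $L^2(S_X\,df)$ and $\eta(\varphi)$ to $\hat\varphi(-f)$ in $L^2(S_\eta\,df)$: the response at time $t$ is the sum of the two elements corresponding to $H_p(f)e^{2\pi i tf}$), and let $$Y_p[n]=Z_p\!\left(\frac{nP}{f_s}\right),\qquad n\in\mathbb Z,$$ be its samples at frequency $f_s/P$. Let $\mathbf Y[\cdot]=(Y_1[\cdot],\dots,Y_P[\cdot])$ and $\tilde X(t)=\mathbb E[X(t)\,|\,\mathbf Y[\cdot]]$. For $f\in\mathbb R$ define the $P\times P$ matrices $$\big(\tilde{\mathbf S}_{\mathbf Y}(f)\big)_{i,j}=\sum_{k\in\mathbb Z}\{S_{X+\eta}H_i^*H_j\}\!\left(f-\tfrac{f_s}{P}k\right),\qquad \big(\mathbf K(f)\big)_{i,j}=\sum_{k\in\mathbb Z}\{S_X^2H_i^*H_j\}\!\left(f-\tfrac{f_s}{P}k\right),$$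 where $\{FG\}(x)=F(x)G(x)$ (the series converge for almost every $f$), and $$\widetilde{\mathbf S}_{X|\mathbf Y}(f)=\tilde{\mathbf S}_{\mathbf Y}^{-\frac12 *}(f)\,\mathbf K(f)\,\tilde{\mathbf S}_{\mathbf Y}^{-\frac12}(f),$$ where $\tilde{\mathbf S}_{\mathbf Y}^{-1/2}$ is the Hermitian inverse square root, taken on the range of $\tilde{\mathbf S}_{\mathbf Y}$ (and $0$ on its kernel) if $\tilde{\mathbf S}_{\mathbf Y}(f)$ is singular. Then $\mathrm{Tr}\,\widetilde{\mathbf S}_{X|\mathbf Y}$ is integrable on $\left(-\frac{f_s}{2P},\frac{f_s}{2P}\right)$, and the MMSE in estimating $X(\cdot)$ from $\mathbf Y[\cdot]$ exists and is given by $$\mathsf{mmse}_{X|\mathbf Y}(f_s)=\lim_{T\to\infty}\frac1{2T}\int_{-T}^{T}\mathbb E\big[(X(t)-\tilde X(t))^2\big]\,dt=\sigma_X^2-\int_{-\frac{f_s}{2P}}^{\frac{f_s}{2P}}\mathrm{Tr}\,\widetilde{\mathbf S}_{X|\mathbf Y}(f)\,df ,$$ and likewise $\lim_{T\to\infty}\mathbb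 E\Big[\frac1{2T}\int_{-T}^{T}(X(t)-\tilde X(t))^2\,dt\Big]$ has this value for every jointly measurable version of $\tilde X(\cdot)$. -/

import Mathlib

open MeasureTheory ProbabilityTheory Filter Topology
open scoped FourierTransform SchwartzMap ComplexConjugate Matrix

noncomputable section

namespace SubNyquist

/-- The spectral measure `S(f) df` of a power spectral density `S`. -/
def specMeasure (S : ℝ → ℝ) : Measure ℝ :=
  volume.withDensity fun f => ENNReal.ofReal (S f)

/-- The complex exponential `f ↦ e^{2πitf}`, the spectral symbol of evaluation at time `t`. -/
def expSymbol (t f : ℝ) : ℂ :=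
  Complex.exp (2 * Real.pi * Complex.I * (t * f))

/-- The spectral symbol `f ↦ ∫ φ(u) e^{2πiuf} du` of integration against a real Schwartz
function `φ`. -/
def testSymbol (φ : 𝓢(ℝ, ℝ)) : ℝ → ℂ :=
  𝓕⁻ (fun u : ℝ => (φ u : ℂ))

/-- The real Schwartz functions against which a generalized process with power spectral density
`S` has finite variance. These are all Schwartz functions as soon as `S` is locally integrable with
`∫ S(f) (1 + f²)^{-N} df < ∞` for some `N`, for instance for white noise (constant `S`). -/
abbrev TestFunction (S : ℝ → ℝ) : Type :=
  {φ : 𝓢(ℝ, ℝ) // MemLp (testSymbol φ) 2 (specMeasure S)}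

/-- A real centered Gaussian family `ξ`, indexed by functionals `i` with spectral symbols `e i`,
whose covariance is `E[ξ i · ξ j] = ∫ e_i(f) conj(e_j(f)) S(f) df`. -/
structure IsGaussianFamily {Ω ι : Type*} [MeasurableSpace Ω] (μ : Measure Ω)
    (e : ι → ℝ → ℂ) (S : ℝ → ℝ) (ξ : ι → Ω → ℝ) : Prop where
  measurable : ∀ i, Measurable (ξ i)
  gaussian : IsGaussianProcess ξ μ
  centered : ∀ i, ∫ ω, ξ i ω ∂μ = 0
  covariance : ∀ i j,
    ((∫ ω, ξ i ω * ξ j ω ∂μ : ℝ) : ℂ) = ∫ f, e i f * conj (e j f) * (S f : ℂ)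

/-- `X` is a real, centered, stationary Gaussian process on `ℝ` with power spectral density `S`:
`E[X(t) X(s)] = ∫ S(f) e^{2πi(t-s)f} df`. -/
def IsStationaryGaussianProcess {Ω : Type*} [MeasurableSpace Ω] (μ : Measure Ω)
    (S : ℝ → ℝ) (X : ℝ → Ω → ℝ) : Prop :=
  IsGaussianFamily μ expSymbol S X

/-- `η` is a real, centered, stationary Gaussian generalized process (given by its values
`η(φ) = "∫ φ(u) η(u) du"` on test functions) with power spectral density `S`, which need not be
integrable. An ordinary process defines a generalized one by integration against `φ`. -/
def IsStationaryGaussianNoise {Ω : Type*} [MeasurableSpace Ω] (μ : Measure Ω)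
    (S : ℝ → ℝ) (η : TestFunction S → Ω → ℝ) : Prop :=
  IsGaussianFamily μ (fun φ => testSymbol φ.1) S η

/-- `Z` is the response of the linear time-invariant system with frequency response `H` to the
input `ξ`: for every time `t`, `Z(t)` is the mean-square limit of real linear combinations of the
values of `ξ` whose spectral symbols converge to `H(f) e^{2πitf}` in `L²(S(f) df)`. This is the
spectral form of `Z(t) = (h ⋆ ξ)(t) = ∫ h(s) ξ(t - s) ds`. The combinations are real, so that the
system has a real impulse response: `H(-f) = conj (H(f))` holds where `S` does not vanish. -/
def IsFilterOutput {Ω ι : Type*} [MeasurableSpace Ω] (μ : Measure Ω)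
    (e : ι → ℝ → ℂ) (S : ℝ → ℝ) (ξ : ι → Ω → ℝ) (H : ℝ → ℂ) (Z : ℝ → Ω → ℝ) : Prop :=
  ∀ t : ℝ, Measurable (Z t) ∧ ∃ c : ℕ → (ι →₀ ℝ),
    Tendsto (fun n => eLpNorm
      (fun f => ((c n).sum fun i a => (a : ℂ) * e i f) - H f * expSymbol t f)
      2 (specMeasure S)) atTop (𝓝 0) ∧
    Tendsto (fun n => eLpNorm
      (fun ω => ((c n).sum fun i a => a * ξ i ω) - Z t ω) 2 μ) atTop (𝓝 0)

/-- `Z = h ⋆ (X + η)`: the response of the system `H` to the source `X` corrupted by the additive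
noise `η`. -/
def IsNoisyFilterOutput {Ω : Type*} [MeasurableSpace Ω] (μ : Measure Ω)
    (SX Sη : ℝ → ℝ) (X : ℝ → Ω → ℝ) (η : TestFunction Sη → Ω → ℝ)
    (H : ℝ → ℂ) (Z : ℝ → Ω → ℝ) : Prop :=
  ∃ U V : ℝ → Ω → ℝ,
    IsFilterOutput μ expSymbol SX X H U ∧
    IsFilterOutput μ (fun φ : TestFunction Sη => testSymbol φ.1) Sη η H V ∧
    ∀ t ω, Z t ω = U t ω + V t ω

/-- The σ-algebra generated by all the samples `Y_p[n]`, `p = 1, …, P`, `n ∈ ℤ`. -/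
abbrev sampleSigma {Ω : Type*} {P : ℕ} (Y : Fin P → ℤ → Ω → ℝ) : MeasurableSpace Ω :=
  ⨆ p : Fin P, ⨆ n : ℤ, MeasurableSpace.comap (Y p n) inferInstance

/-- `‖x‖_T² = (1/2T) ∫_{-T}^{T} x(t)² dt`. -/
def normSqT (T : ℝ) (x : ℝ → ℝ) : ℝ :=
  (2 * T)⁻¹ * ∫ t in (-T)..T, x t ^ 2

/-- `Xt` is a jointly measurable version of the MMSE estimator `t ↦ E[X(t) | m]`. -/
def IsMMSEEstimator {Ω : Type*} [MeasurableSpace Ω] (μ : Measure Ω) (m : MeasurableSpace Ω)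
    (X Xt : ℝ → Ω → ℝ) : Prop :=
  Measurable (Function.uncurry Xt) ∧ ∀ t, Xt t =ᵐ[μ] μ[X t | m]

/-- The matrix with entries `∑_k {(S_X + S_η) H_i^* H_j}(f - f_b k)`, for the sampling frequency
`fb` of each branch. -/
def sampledPSD {P : ℕ} (SX Sη : ℝ → ℝ) (H : Fin P → ℝ → ℂ) (fb f : ℝ) :
    Matrix (Fin P) (Fin P) ℂ :=
  Matrix.of fun i j => ∑' k : ℤ,
    ((SX (f - fb * k) + Sη (f - fb * k) : ℝ) : ℂ) * conj (H i (f - fb * k)) * H j (f - fb * k)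

/-- The matrix with entries `∑_k {S_X² H_i^* H_j}(f - f_b k)`. -/
def crossPSD {P : ℕ} (SX : ℝ → ℝ) (H : Fin P → ℝ → ℂ) (fb f : ℝ) :
    Matrix (Fin P) (Fin P) ℂ :=
  Matrix.of fun i j => ∑' k : ℤ,
    ((SX (f - fb * k) ^ 2 : ℝ) : ℂ) * conj (H i (f - fb * k)) * H j (f - fb * k)

/-- The Hermitian inverse square root `A^{-1/2}` of a positive semidefinite matrix, by functional
calculus: `λ ↦ λ^{-1/2}` on the positive eigenvalues. The eigenvalue `0` is sent to `0`, i.e. if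
`A` is singular the inverse is taken on the range of `A`, which amounts to removing linearly
dependent components. -/
def invSqrt {P : ℕ} (A : Matrix (Fin P) (Fin P) ℂ) : Matrix (Fin P) (Fin P) ℂ :=
  cfc (fun x : ℝ => (Real.sqrt x)⁻¹) A

/-- The matrix `S̃_{X|Y}(f) = S̃_Y^{-1/2 *}(f) K(f) S̃_Y^{-1/2}(f)`. -/
def estimatorPSD {P : ℕ} (SX Sη : ℝ → ℝ) (H : Fin P → ℝ → ℂ) (fb f : ℝ) :
    Matrix (Fin P) (Fin P) ℂ :=
  (invSqrt (sampledPSD SX Sη H fb f))ᴴ * crossPSD SX H fb f * invSqrt (sampledPSD SX Sη H fb f)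

/-- `Tr S̃_{X|Y}(f)`, which is a real number since `S̃_{X|Y}(f)` is Hermitian. -/
def estimatorTrace {P : ℕ} (SX Sη : ℝ → ℝ) (H : Fin P → ℝ → ℂ) (fb f : ℝ) : ℝ :=
  (estimatorPSD SX Sη H fb f).trace.re

end SubNyquist

end

/-! Among jointly Gaussian variables conditional expectation is orthogonal projection, so the error
at time `t` is the squared distance in `L²(μ)` from `X t` to the closed real span of the samples
(`condExp_ae_eq_starProjection`). The spectral isometry carries this distance to `L²(S_X) ⊕
L²(S_η)`. There `X t` becomes `(e_t, 0)` with `e_t(f) = e^{2πitf}`. The sampling times are the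
multiples of `1/f_b`, where `f_b = f_s/P`, so `Y_p[n]` becomes, in both components, the `n`-th
character of the circle `ℝ/f_bℤ` times `H_p`. Enlarging the real span to the complex one does not
change the distance, because the Gram matrix is real (`norm_sub_real_comb_le`). Trigonometric
polynomials being dense in `L²` of a finite measure on the circle, the error is the infimum of
`risk` over symbols `∑ φ_p H_p` with `f_b`-periodic `φ_p` (`mmse_eq_inf_risk`).

Folding the risk integral onto one band decouples the frequencies: at almost every `f` the vector `x
= φ(f)` is free in `ℂ^P`, and the folded integrand is `s - 2 Re x*v + x*Ax`, with `s` the aliased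
source density, `A` the matrix `sampledPSD` and `v` the vector `crossVec`. This is a sum of
nonnegative terms for every `x`, which forces `v` into the range of `A`; completing the square gives
the minimum `s - v*A⁺v` at `x = A⁺v` (`quadratic_eq`). The minimiser may be unbounded in `f`, so
truncations of it approach the infimum (`exists_tendsto_risk`). Hence the error at time `t` is `∫
S_X` minus the integral of `gain` over the band.

Time enters only through `v`, a series of exponentials in `t` with frequencies `f - f_b k`. Shifting
`t` by `1/f_b` multiplies `v` by a unimodular scalar, so the error is periodic and its long-run mean
is the mean over one period. Parseval's identity turns the mean of `conj(v_i) v_j` into `K_{ji}`, so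
the mean of `v*A⁺v` is `Tr(A⁺K) = Tr S̃_{X|Y}` (`IsRegularFreq.integral_gain`). Fubini then handles
the version with the expectation outside the time average. -/

namespace SubNyquist

/-! ### Gaussian Hilbert spaces and conditional expectation. -/

section GaussianHilbertSpace

variable {Ω : Type*} [MeasurableSpace Ω] {μ : Measure Ω}

/-- The elements of `L²(μ)` whose law is a centered Gaussian distribution. -/
def gaussianSet (μ : Measure Ω) : Set (Lp ℝ 2 μ) :=
  {f | ∀ u : ℝ, ∫ ω, Complex.exp (u * f ω * Complex.I) ∂μ
    = Complex.exp (-(u ^ 2 * ‖f‖ ^ 2 : ℝ) / 2)}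

lemma norm_exp_mul_I_sub_le (a b : ℝ) :
    ‖Complex.exp (a * Complex.I) - Complex.exp (b * Complex.I)‖ ≤ |a - b| := by
  have h : Complex.exp (a * Complex.I) - Complex.exp (b * Complex.I)
      = Complex.exp (b * Complex.I) * (Complex.exp (Complex.I * ((a - b : ℝ) : ℂ)) - 1) := by
    rw [mul_sub, mul_one, ← Complex.exp_add]
    congr 2
    push_cast; ring
  rw [h, norm_mul, Complex.norm_exp_ofReal_mul_I, one_mul]
  exact Real.norm_exp_I_mul_ofReal_sub_one_le

lemma integral_norm_le_norm_Lp [IsProbabilityMeasure μ] (f : Lp ℝ 2 μ) :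
    ∫ ω, ‖f ω‖ ∂μ ≤ ‖f‖ := by
  have h1 : MemLp f 1 μ := (Lp.memLp f).mono_exponent (by norm_num)
  rw [Lp.norm_def, integral_norm_eq_lintegral_enorm (Lp.aestronglyMeasurable f),
    ← eLpNorm_one_eq_lintegral_enorm]
  exact ENNReal.toReal_mono (Lp.eLpNorm_ne_top f)
    (eLpNorm_le_eLpNorm_of_exponent_le (by norm_num) (Lp.aestronglyMeasurable f))

lemma integrable_exp_mul_I [IsProbabilityMeasure μ] (f : Lp ℝ 2 μ) (u : ℝ) :
    Integrable (fun ω => Complex.exp (u * f ω * Complex.I)) μ := by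
  refine Integrable.of_bound (C := 1) ?_ ?_
  · have := (Lp.stronglyMeasurable f).measurable
    exact (by fun_prop : Measurable _).aestronglyMeasurable
  · filter_upwards with ω
    rw [← Complex.ofReal_mul, Complex.norm_exp_ofReal_mul_I]

/-- The map is Lipschitz with constant `|u|`: `x ↦ e^{iux}` is `|u|`-Lipschitz, and the `L¹` norm is
at most the `L²` norm on a probability space. -/
lemma continuous_integral_exp_mul_I [IsProbabilityMeasure μ] (u : ℝ) :
    Continuous fun f : Lp ℝ 2 μ => ∫ ω, Complex.exp (u * f ω * Complex.I) ∂μ := by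
  refine (LipschitzWith.of_dist_le_mul (K := ‖u‖₊) fun f g => ?_).continuous
  rw [dist_eq_norm, dist_eq_norm, ← integral_sub (integrable_exp_mul_I f u)
    (integrable_exp_mul_I g u), coe_nnnorm]
  refine (norm_integral_le_integral_norm _).trans ?_
  have hint : Integrable (fun ω => ‖(f - g : Lp ℝ 2 μ) ω‖) μ :=
    ((Lp.memLp (f - g)).integrable (by norm_num)).norm
  calc ∫ ω, ‖Complex.exp (u * f ω * Complex.I) - Complex.exp (u * g ω * Complex.I)‖ ∂μ
      ≤ ∫ ω, ‖u‖ * ‖(f - g : Lp ℝ 2 μ) ω‖ ∂μ := by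
        refine integral_mono_ae ((integrable_exp_mul_I f u).sub (integrable_exp_mul_I g u)).norm
          (hint.const_mul _) ?_
        filter_upwards [Lp.coeFn_sub f g] with ω hω
        rw [hω, Pi.sub_apply, ← norm_mul, mul_sub]
        have := norm_exp_mul_I_sub_le (u * f ω) (u * g ω)
        push_cast at this
        exact this
    _ ≤ ‖u‖ * ‖f - g‖ := by
        rw [integral_const_mul]
        gcongr
        exact integral_norm_le_norm_Lp _

/-- Both sides of the characteristic function identity are continuous in the `L²` norm. This is what
keeps mean-square limits, in particular filter outputs, Gaussian. -/
lemma isClosed_gaussianSet [IsProbabilityMeasure μ] : IsClosed (gaussianSet μ) := by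
  simp only [gaussianSet, Set.ofPred_forall]
  exact isClosed_iInter fun u => isClosed_eq (continuous_integral_exp_mul_I u) (by fun_prop)

lemma map_eq_gaussianReal_of_mem_gaussianSet [IsProbabilityMeasure μ] {f : Lp ℝ 2 μ}
    (hf : f ∈ gaussianSet μ) : μ.map f = gaussianReal 0 (‖f‖ ^ 2).toNNReal := by
  have hm : AEMeasurable f μ := (Lp.aestronglyMeasurable f).aemeasurable
  have : IsProbabilityMeasure (μ.map f) := Measure.isProbabilityMeasure_map hm
  refine Measure.ext_of_charFun (funext fun u => ?_)
  rw [charFun_apply_real, integral_map hm (by fun_prop), hf u, charFun_gaussianReal]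
  congr 1
  rw [Real.coe_toNNReal _ (by positivity)]
  push_cast; ring

lemma integral_eq_zero_of_mem_gaussianSet [IsProbabilityMeasure μ] {f : Lp ℝ 2 μ}
    (hf : f ∈ gaussianSet μ) : ∫ ω, f ω ∂μ = 0 := by
  have hm : AEMeasurable f μ := (Lp.aestronglyMeasurable f).aemeasurable
  have h := integral_map (μ := μ) hm (f := fun x : ℝ => x) (by fun_prop)
  rw [← h, map_eq_gaussianReal_of_mem_gaussianSet hf]
  simp

lemma mem_gaussianSet_of_hasGaussianLaw [IsProbabilityMeasure μ] {f : Lp ℝ 2 μ}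
    (hf : HasGaussianLaw f μ) (h0 : ∫ ω, f ω ∂μ = 0) : f ∈ gaussianSet μ := by
  intro u
  have hm : AEMeasurable f μ := (Lp.aestronglyMeasurable f).aemeasurable
  have h : ∫ ω, Complex.exp (u * f ω * Complex.I) ∂μ = charFun (μ.map f) u := by
    rw [charFun_apply_real, integral_map hm (by fun_prop)]
  have hn : Var[f; μ] = ‖f‖ ^ 2 := by
    rw [variance_of_integral_eq_zero hm h0, ← real_inner_self_eq_norm_sq, L2.inner_def]
    simp [sq]
  rw [h, hf.map_eq_gaussianReal, charFun_gaussianReal, h0, hn,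
    Real.coe_toNNReal _ (by positivity)]
  congr 1
  push_cast; ring

/-- A finite sum in `Lp` is almost everywhere the pointwise sum. -/
lemma coeFn_finset_sum {E ι : Type*} [NormedAddCommGroup E] {p : ENNReal} (s : Finset ι)
    (f : ι → Lp E p μ) : ⇑(∑ i ∈ s, f i) =ᵐ[μ] fun ω => ∑ i ∈ s, f i ω := by
  classical
  induction s using Finset.induction_on with
  | empty => simpa only [Finset.sum_empty] using! Lp.coeFn_zero E p μ
  | insert a s ha ih =>
    rw [Finset.sum_insert ha]
    filter_upwards [Lp.coeFn_add (f a) (∑ i ∈ s, f i), ih] with ω h1 h2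
    rw [h1, Pi.add_apply, h2, Finset.sum_insert ha]

/-- A family of elements of a Gaussian subspace of `L²` is a Gaussian process. -/
lemma isGaussianProcess_of_submodule [IsProbabilityMeasure μ] {E : Submodule ℝ (Lp ℝ 2 μ)}
    (hE : (E : Set (Lp ℝ 2 μ)) ⊆ gaussianSet μ) {κ : Type*} (ζ : κ → Lp ℝ 2 μ)
    (hζ : ∀ k, ζ k ∈ E) : IsGaussianProcess (fun k ω => ζ k ω) μ where
  hasGaussianLaw I := by
    -- Cramér–Wold: a linear functional of finitely many members is again an element `g` of the
    -- subspace `E`, hence Gaussian.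
    refine ⟨isGaussian_of_map_eq_gaussianReal fun L => ?_⟩
    classical
    set g : Lp ℝ 2 μ := ∑ i : I, L (Pi.single i 1) • ζ i with hg
    have hgE : g ∈ E := Submodule.sum_mem _ fun i _ => E.smul_mem _ (hζ _)
    refine ⟨0, (‖g‖ ^ 2).toNNReal, ?_⟩
    rw [← map_eq_gaussianReal_of_mem_gaussianSet (hE hgE)]
    have hm : ∀ i, Measurable (ζ i) := fun i => (Lp.stronglyMeasurable (ζ i)).measurable
    have hm' : Measurable fun ω => I.restrict fun x => ζ x ω :=
      measurable_pi_lambda _ fun i => hm i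
    rw [Measure.map_map (by fun_prop) hm']
    refine Measure.map_congr ?_
    have h1 : ∀ᵐ ω ∂μ, ∀ i : I, (L (Pi.single i 1) • ζ i : Lp ℝ 2 μ) ω
        = L (Pi.single i 1) * ζ i ω := by
      rw [ae_all_iff]
      intro i
      filter_upwards [Lp.coeFn_smul (L (Pi.single i 1)) (ζ i)] with ω hω
      rw [hω]; rfl
    filter_upwards [coeFn_finset_sum Finset.univ
      (fun i : I => L (Pi.single i 1) • ζ i), h1] with ω hω h1ω
    rw [hg, hω]
    simp only [h1ω, Function.comp_apply]
    have := L.toLinearMap.pi_apply_eq_sum_univ (I.restrict fun x => ζ x ω)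
    refine this.trans ?_
    simp only [ContinuousLinearMap.coe_coe, Finset.restrict, smul_eq_mul]
    refine Finset.sum_congr rfl fun i _ => ?_
    rw [mul_comm]
    congr 2
    ext j
    simp [Pi.single_apply, eq_comm]

end GaussianHilbertSpace

/-- In a Gaussian subspace of `L²`, the conditional expectation given a family of variables is the
orthogonal projection to the closed linear span of the family. -/
lemma condExp_ae_eq_starProjection {Ω : Type*} {m : MeasurableSpace Ω} [mΩ : MeasurableSpace Ω]
    {μ : Measure Ω} [IsProbabilityMeasure μ] {E : Submodule ℝ (Lp ℝ 2 μ)}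
    (hE : (E : Set (Lp ℝ 2 μ)) ⊆ gaussianSet μ) (hEc : IsClosed (E : Set (Lp ℝ 2 μ)))
    {κ : Type*} {Y : κ → Ω → ℝ} (hY : ∀ k, Measurable (Y k)) (y : κ → Lp ℝ 2 μ)
    (hyY : ∀ k, y k =ᵐ[μ] Y k) (hy : ∀ k, y k ∈ E) {x : Lp ℝ 2 μ} (hx : x ∈ E)
    (hm_def : m = ⨆ k, MeasurableSpace.comap (Y k) inferInstance) :
    μ[x | m] =ᵐ[μ] (Submodule.span ℝ (Set.range y)).topologicalClosure.starProjection x := by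
  set F := (Submodule.span ℝ (Set.range y)).topologicalClosure with hF
  have hm : m ≤ mΩ := hm_def ▸ iSup_le fun k => (hY k).comap_le
  have hFE : F ≤ E := Submodule.topologicalClosure_minimal _
    (Submodule.span_le.2 (by rintro _ ⟨k, rfl⟩; exact hy k)) hEc
  have hYm : ∀ k, Measurable[m] (Y k) := fun k =>
    (comap_measurable (Y k)).mono
      (hm_def ▸ le_iSup (fun k => MeasurableSpace.comap (Y k) inferInstance) k) le_rfl
  have hFm : F ≤ lpMeas ℝ ℝ m 2 μ := by
    have : Fact (m ≤ mΩ) := ⟨hm⟩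
    refine Submodule.topologicalClosure_minimal _ (Submodule.span_le.2 ?_) ?_
    · rintro _ ⟨k, rfl⟩
      exact mem_lpMeas_iff_aestronglyMeasurable.2 ⟨Y k, (hYm k).stronglyMeasurable, hyY k⟩
    · exact (completeSpace_coe_iff_isComplete.1 (inferInstanceAs
        (CompleteSpace (lpMeas ℝ ℝ m 2 μ)))).isClosed
  set w := F.starProjection x with hw
  have hwF : w ∈ F := F.starProjection_apply_mem x
  set r := x - w with hr
  have hrE : r ∈ E := E.sub_mem hx (hFE hwF)
  have hry : ∀ k, ∫ ω, r ω * Y k ω ∂μ = 0 := fun k => by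
    have h := F.starProjection_inner_eq_zero x (y k)
      (Submodule.le_topologicalClosure _ (Submodule.subset_span ⟨k, rfl⟩))
    rw [← hw, ← hr, L2.inner_def] at h
    refine Eq.trans ?_ h
    refine integral_congr_ae ?_
    filter_upwards [hyY k] with ω hω
    simp [hω, mul_comm]
  have hrm : Measurable r := (Lp.stronglyMeasurable r).measurable
  -- The residual is uncorrelated with each observation and jointly Gaussian with all of them, hence
  -- independent of the whole family. The index type `Unit` makes the residual a process.
  have hind : IndepFun (fun ω (_ : Unit) => r ω) (fun ω k => Y k ω) μ := by
    have hG := isGaussianProcess_of_submodule hE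
      (Sum.elim (fun _ : Unit => r) y) (by rintro (k | k); exacts [hrE, hy k])
    have hG' : IsGaussianProcess (Sum.elim (fun (_ : Unit) ω => r ω) (fun k ω => Y k ω)) μ := by
      refine hG.congr ?_
      rintro (k | k)
      exacts [EventuallyEq.rfl, hyY k]
    refine hG'.indepFun_of_covariance_eq_zero (fun _ => hrm.aemeasurable)
      (fun k => (hY k).aemeasurable) fun _ k => ?_
    rw [covariance_eq_sub (Lp.memLp _) ((memLp_congr_ae (hyY k)).1 (Lp.memLp _)),
      integral_eq_zero_of_mem_gaussianSet (hE hrE), zero_mul, sub_zero]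
    exact hry k
  have hcr : μ[r | m] =ᵐ[μ] 0 := by
    have hi : Indep (MeasurableSpace.comap (fun ω (_ : Unit) => r ω) inferInstance) m μ := by
      have := (IndepFun_iff_Indep _ _ _).1 hind
      rwa [MeasurableSpace.comap_process_pi Y, ← hm_def] at this
    have h := condExp_indep_eq (measurable_pi_lambda _ fun _ => hrm).comap_le hm
      (f := r) ?_ hi
    · rw [integral_eq_zero_of_mem_gaussianSet (hE hrE)] at h
      exact h
    · have := (measurable_pi_apply ()).comp
        (comap_measurable (m := MeasurableSpace.pi) (fun ω (_ : Unit) => r ω))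
      exact this.stronglyMeasurable
  have hxr : (x : Ω → ℝ) =ᵐ[μ] ⇑w + ⇑r := by
    filter_upwards [Lp.coeFn_sub x w] with ω hω
    rw [Pi.add_apply, hr, hω, Pi.sub_apply]; ring
  have hwi : Integrable w μ := (Lp.memLp w).integrable (by norm_num)
  have hri : Integrable r μ := (Lp.memLp r).integrable (by norm_num)
  have hcw : μ[w | m] =ᵐ[μ] w :=
    condExp_of_aestronglyMeasurable' hm (mem_lpMeas_iff_aestronglyMeasurable.1 (hFm hwF)) hwi
  filter_upwards [condExp_congr_ae (m := m) hxr, condExp_add hwi hri m, hcw, hcr]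
    with ω h1 h2 h3 h4
  rw [h1, h2, Pi.add_apply, h3, h4]
  simp

end SubNyquist

namespace SubNyquist

/-! ### Real and complex Hilbert spaces with the same Gram matrix. -/

section Gram

variable {G K ι : Type*} [NormedAddCommGroup G] [InnerProductSpace ℝ G]
  [NormedAddCommGroup K] [InnerProductSpace ℂ K]

/-- The pair of real linear combinations of the families `g` and `k` with coefficients `c`. -/
noncomputable def combPair (g : ι → G) (k : ι → K) (c : ι →₀ ℝ) : G × K :=
  (c.sum fun i a => a • g i, c.sum fun i a => (a : ℂ) • k i)

/-- The closure of the graph of the correspondence `g i ↦ k i`, extended real-linearly. -/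
def spectralGraph (g : ι → G) (k : ι → K) : Set (G × K) :=
  closure (Set.range (combPair g k))

lemma combPair_add (g : ι → G) (k : ι → K) (c d : ι →₀ ℝ) :
    combPair g k (c + d) = combPair g k c + combPair g k d := by
  classical
  refine Prod.ext ?_ ?_
  · exact Finsupp.sum_add_index' (h := fun i (a : ℝ) => a • g i) (by simp)
      (by intros; rw [add_smul])
  · exact Finsupp.sum_add_index' (h := fun i (a : ℝ) => (a : ℂ) • k i) (by simp)
      (by intros; rw [Complex.ofReal_add, add_smul])

lemma add_mem_spectralGraph {g : ι → G} {k : ι → K} {a b : G × K}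
    (ha : a ∈ spectralGraph g k) (hb : b ∈ spectralGraph g k) : a + b ∈ spectralGraph g k := by
  refine map_mem_closure₂ continuous_add ha hb ?_
  rintro _ ⟨c, rfl⟩ _ ⟨d, rfl⟩
  exact ⟨c + d, combPair_add g k c d⟩

lemma mem_spectralGraph_self (g : ι → G) (k : ι → K) (i : ι) :
    (g i, k i) ∈ spectralGraph g k :=
  subset_closure ⟨Finsupp.single i 1, by simp [combPair]⟩

lemma fst_mem_of_mem_spectralGraph {g : ι → G} {k : ι → K} {a : G × K}
    (ha : a ∈ spectralGraph g k) :
    a.1 ∈ (Submodule.span ℝ (Set.range g)).topologicalClosure := by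
  refine map_mem_closure continuous_fst ha ?_
  rintro _ ⟨c, rfl⟩
  exact Submodule.sum_mem _ fun i _ => Submodule.smul_mem _ _ (Submodule.subset_span ⟨i, rfl⟩)

/-- If two families have the same Gram matrix, the extended correspondence preserves inner
products. -/
lemma inner_eq_of_mem_spectralGraph {g : ι → G} {k : ι → K}
    (h : ∀ i j, ((inner ℝ (g i) (g j) : ℝ) : ℂ) = inner ℂ (k i) (k j)) {a b : G × K}
    (ha : a ∈ spectralGraph g k) (hb : b ∈ spectralGraph g k) :
    ((inner ℝ a.1 b.1 : ℝ) : ℂ) = inner ℂ a.2 b.2 := by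
  have hcl : IsClosed {p : (G × K) × (G × K) |
      ((inner ℝ p.1.1 p.2.1 : ℝ) : ℂ) = inner ℂ p.1.2 p.2.2} :=
    isClosed_eq (by fun_prop) (by fun_prop)
  -- A product of closures is the closure of the product, so the identity need only be checked on
  -- finite combinations.
  have hab : (a, b) ∈ closure (Set.range (combPair g k) ×ˢ Set.range (combPair g k)) := by
    rw [closure_prod_eq]; exact ⟨ha, hb⟩
  refine closure_minimal ?_ hcl hab
  rintro ⟨_, _⟩ ⟨⟨c, rfl⟩, ⟨d, rfl⟩⟩
  simp only [combPair, Finsupp.sum, Set.mem_ofPred_eq, sum_inner, inner_sum, inner_smul_left,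
    inner_smul_right, Complex.ofReal_sum, Complex.ofReal_mul, h, Complex.conj_ofReal,
    conj_trivial]

variable {κ : Type*} {x : G} {x' : K} {y : κ → G} {y' : κ → K}

/-- The inner products on the complex side are all real, so the real and imaginary parts of the
coefficients contribute orthogonally to the norm. Imaginary parts can therefore only increase the
distance. -/
lemma norm_sub_real_comb_le
    (hxx : ((inner ℝ x x : ℝ) : ℂ) = inner ℂ x' x')
    (hxy : ∀ i, ((inner ℝ x (y i) : ℝ) : ℂ) = inner ℂ x' (y' i))
    (hyy : ∀ i j, ((inner ℝ (y i) (y j) : ℝ) : ℂ) = inner ℂ (y' i) (y' j))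
    (s : Finset κ) (c : κ → ℂ) :
    ‖x - ∑ i ∈ s, (c i).re • y i‖ ^ 2 + ‖∑ i ∈ s, (c i).im • y i‖ ^ 2
      = ‖x' - ∑ i ∈ s, c i • y' i‖ ^ 2 := by
  set a := x - ∑ i ∈ s, (c i).re • y i with ha
  set b := ∑ i ∈ s, (c i).im • y i with hb
  set a' := x' - ∑ i ∈ s, ((c i).re : ℂ) • y' i with ha'
  set b' := ∑ i ∈ s, ((c i).im : ℂ) • y' i with hb'
  have hyx : ∀ i, ((inner ℝ (y i) x : ℝ) : ℂ) = inner ℂ (y' i) x' := fun i => by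
    rw [real_inner_comm, ← inner_conj_symm (y' i), ← hxy, Complex.conj_ofReal]
  have haa : ((inner ℝ a a : ℝ) : ℂ) = inner ℂ a' a' := by
    simp only [ha, ha', inner_sub_left, inner_sub_right, sum_inner, inner_sum, inner_smul_left,
      inner_smul_right, Complex.ofReal_sum, Complex.ofReal_mul, Complex.ofReal_sub, hxx, hxy, hyx,
      hyy, Complex.conj_ofReal, conj_trivial]
  have hbb : ((inner ℝ b b : ℝ) : ℂ) = inner ℂ b' b' := by
    simp only [hb, hb', sum_inner, inner_sum, inner_smul_left,
      inner_smul_right, Complex.ofReal_sum, Complex.ofReal_mul,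
      hyy, Complex.conj_ofReal, conj_trivial]
  have hab : ((inner ℝ a b : ℝ) : ℂ) = inner ℂ a' b' := by
    simp only [ha, ha', hb, hb', inner_sub_left, sum_inner, inner_sum, inner_smul_left,
      inner_smul_right, Complex.ofReal_sum, Complex.ofReal_mul, Complex.ofReal_sub, hxy, hyy,
      Complex.conj_ofReal, conj_trivial]
  have hsum : x' - ∑ i ∈ s, c i • y' i = a' - Complex.I • b' := by
    rw [ha', hb', Finset.smul_sum, sub_sub, ← Finset.sum_add_distrib]
    congr 1
    refine Finset.sum_congr rfl fun i _ => ?_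
    rw [smul_smul, ← add_smul, mul_comm, Complex.re_add_im]
  -- The cross term is the real part of `i` times the real number `⟨a, b⟩`, so it vanishes.
  rw [hsum, @norm_sub_sq ℂ K, inner_smul_right, ← hab, norm_smul, Complex.norm_I, one_mul,
    ← real_inner_self_eq_norm_sq, ← real_inner_self_eq_norm_sq,
    ← @inner_self_eq_norm_sq ℂ K, ← @inner_self_eq_norm_sq ℂ K, ← haa, ← hbb]
  simp [-Complex.ofReal_pow]

/-- The distance of `x` to the real span of `y` is the distance of `x'` to the complex span of
`y'`, if the Gram matrices agree: the complex distance is not smaller. -/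
lemma norm_sub_starProjection_le [CompleteSpace G]
    (hxx : ((inner ℝ x x : ℝ) : ℂ) = inner ℂ x' x')
    (hxy : ∀ i, ((inner ℝ x (y i) : ℝ) : ℂ) = inner ℂ x' (y' i))
    (hyy : ∀ i j, ((inner ℝ (y i) (y j) : ℝ) : ℂ) = inner ℂ (y' i) (y' j))
    {z : K} (hz : z ∈ (Submodule.span ℂ (Set.range y')).topologicalClosure) :
    ‖x - (Submodule.span ℝ (Set.range y)).topologicalClosure.starProjection x‖ ≤ ‖x' - z‖ := by
  set F := (Submodule.span ℝ (Set.range y)).topologicalClosure with hF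
  have hcl : IsClosed {z : K | ‖x - F.starProjection x‖ ≤ ‖x' - z‖} :=
    isClosed_le (by fun_prop) (by fun_prop)
  refine closure_minimal ?_ hcl hz
  intro z hz
  obtain ⟨c, rfl⟩ := Finsupp.mem_span_range_iff_exists_finsupp.1 hz
  have h := norm_sub_real_comb_le hxx hxy hyy c.support c
  have h1 : ‖x - F.starProjection x‖ ≤ ‖x - ∑ i ∈ c.support, (c i).re • y i‖ := by
    rw [F.starProjection_minimal]
    refine ciInf_le (f := fun w : F => ‖x - w‖) ⟨0, ?_⟩ ⟨∑ i ∈ c.support, (c i).re • y i, ?_⟩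
    · rintro _ ⟨w, rfl⟩; exact norm_nonneg _
    · exact Submodule.sum_mem _ fun i _ => Submodule.smul_mem _ _
        (Submodule.le_topologicalClosure _ (Submodule.subset_span ⟨i, rfl⟩))
  refine h1.trans ((sq_le_sq₀ (norm_nonneg _) (norm_nonneg _)).1 ?_)
  rw [Finsupp.sum, ← h]
  linarith [sq_nonneg ‖∑ i ∈ c.support, (c i).im • y i‖]

/-- A real combination close to the projection, with its coefficients read as complex numbers, is
equally far from `x'`. This is the converse of `norm_sub_starProjection_le`. -/
lemma exists_norm_sub_sq_lt [CompleteSpace G]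
    (hxx : ((inner ℝ x x : ℝ) : ℂ) = inner ℂ x' x')
    (hxy : ∀ i, ((inner ℝ x (y i) : ℝ) : ℂ) = inner ℂ x' (y' i))
    (hyy : ∀ i j, ((inner ℝ (y i) (y j) : ℝ) : ℂ) = inner ℂ (y' i) (y' j))
    {ε : ℝ} (hε : 0 < ε) :
    ∃ c : κ →₀ ℂ, ‖x' - c.sum fun i a => a • y' i‖ ^ 2
      < ‖x - (Submodule.span ℝ (Set.range y)).topologicalClosure.starProjection x‖ ^ 2 + ε := by
  set F := (Submodule.span ℝ (Set.range y)).topologicalClosure with hF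
  have hopen : IsOpen {z : G | ‖x - z‖ ^ 2 < ‖x - F.starProjection x‖ ^ 2 + ε} :=
    isOpen_lt (by fun_prop) (by fun_prop)
  obtain ⟨z, hz, hzs⟩ := mem_closure_iff.1 (F.starProjection_apply_mem x) _ hopen
    (by simpa using hε)
  obtain ⟨c, rfl⟩ := Finsupp.mem_span_range_iff_exists_finsupp.1 hzs
  refine ⟨c.mapRange (fun r : ℝ => (r : ℂ)) (by simp), ?_⟩
  have h := norm_sub_real_comb_le hxx hxy hyy c.support (fun i => (c i : ℂ))
  simp only [Complex.ofReal_re, Complex.ofReal_im, zero_smul, Finset.sum_const_zero, norm_zero]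
    at h
  rw [Finsupp.sum_mapRange_index (by simp), Finsupp.sum, ← h]
  simpa [Finsupp.sum] using hz

end Gram

end SubNyquist

namespace SubNyquist

/-! ### Spectral isometry of a Gaussian family and filter outputs. -/

section Spectral

lemma coeFn_sum_smul_toLp {α ι 𝕜 : Type*} [MeasurableSpace α] [RCLike 𝕜] {ν : Measure α}
    (s : Finset ι) (c : ι → 𝕜) {u : ι → α → 𝕜} (hu : ∀ i, MemLp (u i) 2 ν) :
    ⇑(∑ i ∈ s, c i • (hu i).toLp (u i)) =ᵐ[ν] fun a => ∑ i ∈ s, c i * u i a := by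
  have h1 : ∀ᵐ a ∂ν, ∀ i : s, (c i • (hu i).toLp (u i) : Lp 𝕜 2 ν) a = c i * u i a := by
    rw [ae_all_iff]
    intro i
    filter_upwards [Lp.coeFn_smul (c i) ((hu i).toLp (u i)), (hu i).coeFn_toLp] with a h1 h2
    rw [h1, Pi.smul_apply, h2, smul_eq_mul]
  filter_upwards [coeFn_finset_sum s (fun i => c i • (hu i).toLp (u i)), h1] with a h2 h3
  rw [h2]
  exact Finset.sum_congr rfl fun i hi => h3 ⟨i, hi⟩

lemma norm_expSymbol (t f : ℝ) : ‖expSymbol t f‖ = 1 := by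
  have : expSymbol t f = Complex.exp ((2 * Real.pi * (t * f) : ℝ) * Complex.I) := by
    rw [expSymbol]; congr 1; push_cast; ring
  rw [this, Complex.norm_exp_ofReal_mul_I]

@[fun_prop]
lemma continuous_expSymbol (t : ℝ) : Continuous (expSymbol t) := by
  unfold expSymbol; fun_prop

lemma integral_specMeasure {S : ℝ → ℝ} (hS : Measurable S) (hS0 : ∀ f, 0 ≤ S f) (F : ℝ → ℂ) :
    ∫ f, F f ∂(specMeasure S) = ∫ f, F f * (S f : ℂ) := by
  rw [specMeasure, integral_withDensity_eq_integral_toReal_smul (by fun_prop) (by simp)]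
  refine integral_congr_ae (Eventually.of_forall fun f => ?_)
  simp [ENNReal.toReal_ofReal (hS0 f), mul_comm]

lemma lintegral_specMeasure {S : ℝ → ℝ} (hS : Measurable S) {F : ℝ → ENNReal}
    (hF : Measurable F) :
    ∫⁻ f, F f ∂(specMeasure S) = ∫⁻ f, ENNReal.ofReal (S f) * F f := by
  rw [specMeasure, lintegral_withDensity_eq_lintegral_mul _ (by fun_prop) hF]
  rfl

lemma isFiniteMeasure_specMeasure {S : ℝ → ℝ} (hS : Integrable S) :
    IsFiniteMeasure (specMeasure S) :=
  isFiniteMeasure_withDensity_ofReal hS.2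

lemma memLp_expSymbol {S : ℝ → ℝ} (hS : Integrable S) (t : ℝ) :
    MemLp (expSymbol t) 2 (specMeasure S) := by
  have := isFiniteMeasure_specMeasure hS
  exact MemLp.of_bound (continuous_expSymbol t).aestronglyMeasurable 1
    (Eventually.of_forall fun f => (norm_expSymbol t f).le)

variable {Ω ι : Type*} [MeasurableSpace Ω] {μ : Measure Ω} {e : ι → ℝ → ℂ} {S : ℝ → ℝ}
  {ξ : ι → Ω → ℝ}

lemma IsGaussianFamily.memLp (h : IsGaussianFamily μ e S ξ) (i : ι) : MemLp (ξ i) 2 μ :=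
  (h.gaussian.hasGaussianLaw_eval i).memLp_two

lemma IsGaussianFamily.inner_eq (h : IsGaussianFamily μ e S ξ) (hS : Measurable S)
    (hS0 : ∀ f, 0 ≤ S f) (he : ∀ i, MemLp (e i) 2 (specMeasure S)) (i j : ι) :
    ((inner ℝ ((h.memLp i).toLp (ξ i)) ((h.memLp j).toLp (ξ j)) : ℝ) : ℂ)
      = inner ℂ ((he i).toLp (e i)) ((he j).toLp (e j)) := by
  rw [L2.inner_def, L2.inner_def]
  have h1 : ∫ ω, inner ℝ (((h.memLp i).toLp (ξ i)) ω) (((h.memLp j).toLp (ξ j)) ω) ∂μ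
      = ∫ ω, ξ j ω * ξ i ω ∂μ := by
    refine integral_congr_ae ?_
    filter_upwards [(h.memLp i).coeFn_toLp, (h.memLp j).coeFn_toLp] with ω h1 h2
    simp [h1, h2]
  have h2 : ∫ f, inner ℂ (((he i).toLp (e i)) f) (((he j).toLp (e j)) f) ∂(specMeasure S)
      = ∫ f, e j f * conj (e i f) ∂(specMeasure S) := by
    refine integral_congr_ae ?_
    filter_upwards [(he i).coeFn_toLp, (he j).coeFn_toLp] with ω h1 h2
    simp [h1, h2]
  rw [h1, h2, h.covariance, integral_specMeasure hS hS0]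

/-- The linear combinations of a Gaussian family, as functions of the sample path. -/
lemma IsGaussianFamily.ae_eq_of_mem_span (h : IsGaussianFamily μ e S ξ) {u : Lp ℝ 2 μ}
    (hu : u ∈ Submodule.span ℝ (Set.range fun i => (h.memLp i).toLp (ξ i))) :
    ∃ c : ι →₀ ℝ, u =ᵐ[μ] fun ω => c.sum fun i a => a * ξ i ω := by
  obtain ⟨c, rfl⟩ := Finsupp.mem_span_range_iff_exists_finsupp.1 hu
  exact ⟨c, coeFn_sum_smul_toLp c.support c h.memLp⟩

lemma IsGaussianFamily.hasGaussianLaw_sum (h : IsGaussianFamily μ e S ξ) (c : ι →₀ ℝ) :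
    HasGaussianLaw (fun ω => c.sum fun i a => a * ξ i ω) μ :=
  (h.gaussian.smul c).hasGaussianLaw_fun_sum (I := c.support)

lemma IsGaussianFamily.integral_sum (h : IsGaussianFamily μ e S ξ) [IsProbabilityMeasure μ]
    (c : ι →₀ ℝ) :
    ∫ ω, (c.sum fun i a => a * ξ i ω) ∂μ = 0 := by
  simp only [Finsupp.sum]
  rw [integral_finsetSum _ fun i _ => ((h.memLp i).integrable (by norm_num)).const_mul _]
  simp [integral_const_mul, h.centered]

variable {ι' : Type*} {e' : ι' → ℝ → ℂ} {S' : ℝ → ℝ} {ξ' : ι' → Ω → ℝ}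

/-- The closed linear span of two independent centered Gaussian families consists of centered
Gaussian variables. -/
lemma IsGaussianFamily.span_sum_subset_gaussianSet [IsProbabilityMeasure μ]
    (h : IsGaussianFamily μ e S ξ) (h' : IsGaussianFamily μ e' S' ξ')
    (hind : IndepFun (fun ω i => ξ i ω) (fun ω i => ξ' i ω) μ) :
    ((Submodule.span ℝ (Set.range (Sum.elim (fun i => (h.memLp i).toLp (ξ i))
      (fun i => (h'.memLp i).toLp (ξ' i))))).topologicalClosure : Set (Lp ℝ 2 μ))
      ⊆ gaussianSet μ := by
  refine closure_minimal ?_ isClosed_gaussianSet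
  intro z (hz : z ∈ Submodule.span ℝ _)
  rw [Set.Sum.elim_range, Submodule.span_union, Submodule.mem_sup] at hz
  obtain ⟨u, hu, v, hv, rfl⟩ := hz
  obtain ⟨c, hc⟩ := h.ae_eq_of_mem_span hu
  obtain ⟨d, hd⟩ := h'.ae_eq_of_mem_span hv
  have hsum : (⇑(u + v) : Ω → ℝ) =ᵐ[μ]
      fun ω => (c.sum fun i a => a * ξ i ω) + d.sum fun i a => a * ξ' i ω := by
    filter_upwards [Lp.coeFn_add u v, hc, hd] with ω h1 h2 h3
    rw [h1, Pi.add_apply, h2, h3]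
  have hi : IndepFun (fun ω => c.sum fun i a => a * ξ i ω)
      (fun ω => d.sum fun i a => a * ξ' i ω) μ := by
    have hm : Measurable fun x : ι → ℝ => c.sum fun i a => a * x i := by
      simp only [Finsupp.sum]; fun_prop
    have hm' : Measurable fun x : ι' → ℝ => d.sum fun i a => a * x i := by
      simp only [Finsupp.sum]; fun_prop
    exact hind.comp hm hm'
  have hg := (hi.hasGaussianLaw (h.hasGaussianLaw_sum c) (h'.hasGaussianLaw_sum d)).fun_add
  refine mem_gaussianSet_of_hasGaussianLaw (hg.congr hsum.symm) ?_
  rw [integral_congr_ae hsum, integral_add, h.integral_sum, h'.integral_sum, add_zero]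
  · exact (h.hasGaussianLaw_sum c).integrable
  · exact (h'.hasGaussianLaw_sum d).integrable

lemma IsGaussianFamily.inner_eq_zero [IsProbabilityMeasure μ]
    (h : IsGaussianFamily μ e S ξ) (h' : IsGaussianFamily μ e' S' ξ')
    (hind : IndepFun (fun ω i => ξ i ω) (fun ω i => ξ' i ω) μ) (i : ι) (j : ι') :
    inner ℝ ((h.memLp i).toLp (ξ i)) ((h'.memLp j).toLp (ξ' j)) = 0 := by
  rw [L2.inner_def]
  have h1 : ∫ ω, inner ℝ (((h.memLp i).toLp (ξ i)) ω) (((h'.memLp j).toLp (ξ' j)) ω) ∂μ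
      = ∫ ω, ξ i ω * ξ' j ω ∂μ := by
    refine integral_congr_ae ?_
    filter_upwards [(h.memLp i).coeFn_toLp, (h'.memLp j).coeFn_toLp] with ω h1 h2
    simp [h1, h2, mul_comm]
  have hi : IndepFun (ξ i) (ξ' j) μ :=
    hind.comp (measurable_pi_apply i) (measurable_pi_apply j)
  rw [h1, hi.integral_fun_mul_eq_mul_integral (h.measurable i).aestronglyMeasurable
    (h'.measurable j).aestronglyMeasurable, h.centered, zero_mul]

lemma memLp_of_eLpNorm_sub_tendsto {α E : Type*} [MeasurableSpace α] [NormedAddCommGroup E]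
    {ν : Measure α} {u : ℕ → α → E} {v : α → E} (hu : ∀ n, MemLp (u n) 2 ν)
    (hv : AEStronglyMeasurable v ν)
    (h : Tendsto (fun n => eLpNorm (fun a => u n a - v a) 2 ν) atTop (𝓝 0)) : MemLp v 2 ν := by
  obtain ⟨n, hn⟩ := (h.eventually (gt_mem_nhds ENNReal.zero_lt_top)).exists
  have h1 : MemLp (fun a => u n a - v a) 2 ν := ⟨(hu n).1.sub hv, hn⟩
  have := (hu n).sub h1
  refine this.congr_norm hv (Eventually.of_forall fun a => ?_)
  simp

/-- The response of a linear system is related to its symbol by the spectral isometry. -/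
lemma IsFilterOutput.mem_spectralGraph {H : ℝ → ℂ} {Z : ℝ → Ω → ℝ}
    (hZ : IsFilterOutput μ e S ξ H Z) (h : IsGaussianFamily μ e S ξ)
    (he : ∀ i, MemLp (e i) 2 (specMeasure S)) (hH : Measurable H) (t : ℝ) :
    ∃ (h1 : MemLp (Z t) 2 μ) (h2 : MemLp (fun f => H f * expSymbol t f) 2 (specMeasure S)),
      (h1.toLp, h2.toLp) ∈ spectralGraph (fun i => (h.memLp i).toLp (ξ i))
        (fun i => (he i).toLp (e i)) := by
  obtain ⟨hZm, c, hc1, hc2⟩ := hZ t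
  have hm1 : ∀ n, MemLp (fun f => (c n).sum fun i a => (a : ℂ) * e i f) 2 (specMeasure S) :=
    fun n => memLp_finsetSum _ fun i _ => (he i).const_mul _
  have hm2 : ∀ n, MemLp (fun ω => (c n).sum fun i a => a * ξ i ω) 2 μ :=
    fun n => memLp_finsetSum _ fun i _ => (h.memLp i).const_mul _
  have h1 : MemLp (Z t) 2 μ := memLp_of_eLpNorm_sub_tendsto hm2 hZm.aestronglyMeasurable hc2
  have h2 : MemLp (fun f => H f * expSymbol t f) 2 (specMeasure S) :=
    memLp_of_eLpNorm_sub_tendsto hm1 (by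
      exact (hH.mul (continuous_expSymbol t).measurable).aestronglyMeasurable) hc1
  refine ⟨h1, h2, mem_closure_of_tendsto
    (f := fun n => combPair (fun i => (h.memLp i).toLp (ξ i))
        (fun i => (he i).toLp (e i)) (c n)) (b := atTop) ?_
    (Eventually.of_forall fun n => ⟨c n, rfl⟩)⟩
  have e1 : ∀ n, combPair (fun i => (h.memLp i).toLp (ξ i)) (fun i => (he i).toLp (e i)) (c n)
      = ((hm2 n).toLp, (hm1 n).toLp) := by
    intro n
    refine Prod.ext ?_ ?_
    · exact Lp.ext ((coeFn_sum_smul_toLp (c n).support (c n) h.memLp).trans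
        (hm2 n).coeFn_toLp.symm)
    · exact Lp.ext ((coeFn_sum_smul_toLp (c n).support (fun i => (c n i : ℂ)) he).trans
        (hm1 n).coeFn_toLp.symm)
  simp only [e1]
  refine Tendsto.prodMk_nhds ?_ ?_
  · exact (Lp.tendsto_Lp_iff_tendsto_eLpNorm'' _ hm2 _ h1).2 hc2
  · exact (Lp.tendsto_Lp_iff_tendsto_eLpNorm'' _ hm1 _ h2).2 hc1

end Spectral

end SubNyquist

namespace SubNyquist

/-! ### The joint spectral space of source and noise. -/

section SpectralPair

/-- The spectral Hilbert space of the pair of independent sources with spectral densities `SX`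
and `Sη`. -/
abbrev SpecPair (SX Sη : ℝ → ℝ) : Type :=
  WithLp 2 (Lp ℂ 2 (specMeasure SX) × Lp ℂ 2 (specMeasure Sη))

/-- The element of the spectral Hilbert space given by a pair of square-integrable symbols. -/
noncomputable abbrev specPair {SX Sη : ℝ → ℝ} {a b : ℝ → ℂ} (ha : MemLp a 2 (specMeasure SX))
    (hb : MemLp b 2 (specMeasure Sη)) : SpecPair SX Sη :=
  WithLp.toLp 2 (ha.toLp a, hb.toLp b)

variable {SX Sη : ℝ → ℝ}

lemma ofReal_norm_toLp_sq {α : Type*} [MeasurableSpace α] {ν : Measure α} {a : α → ℂ}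
    (ha : MemLp a 2 ν) : ENNReal.ofReal (‖ha.toLp a‖ ^ 2) = ∫⁻ x, ‖a x‖ₑ ^ 2 ∂ν := by
  have h := eLpNorm_nnreal_pow_eq_lintegral (μ := ν) (f := a) (p := 2) (by norm_num)
  rw [Lp.norm_toLp, ENNReal.ofReal_pow ENNReal.toReal_nonneg, ENNReal.ofReal_toReal ha.2.ne]
  simpa using h

lemma ofReal_norm_specPair_sq (hSX : Measurable SX) (hSη : Measurable Sη) {a b : ℝ → ℂ}
    (ham : Measurable a) (hbm : Measurable b)
    (ha : MemLp a 2 (specMeasure SX)) (hb : MemLp b 2 (specMeasure Sη)) :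
    ENNReal.ofReal (‖specPair ha hb‖ ^ 2)
      = ∫⁻ f, (ENNReal.ofReal (SX f) * ‖a f‖ₑ ^ 2 + ENNReal.ofReal (Sη f) * ‖b f‖ₑ ^ 2) := by
  rw [WithLp.prod_norm_sq_eq_of_L2, ENNReal.ofReal_add (by positivity) (by positivity)]
  simp only [WithLp.toLp_fst, WithLp.toLp_snd]
  rw [ofReal_norm_toLp_sq, ofReal_norm_toLp_sq, lintegral_specMeasure hSX (by fun_prop),
    lintegral_specMeasure hSη (by fun_prop), lintegral_add_left (by fun_prop)]

lemma specPair_congr {a b a' b' : ℝ → ℂ} (ha : MemLp a 2 (specMeasure SX))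
    (hb : MemLp b 2 (specMeasure Sη)) (ha' : MemLp a' 2 (specMeasure SX))
    (hb' : MemLp b' 2 (specMeasure Sη)) (h1 : a = a') (h2 : b = b') :
    specPair ha hb = specPair ha' hb' := by
  subst h1 h2; rfl

lemma specPair_sub {a b a' b' : ℝ → ℂ} (ha : MemLp a 2 (specMeasure SX))
    (hb : MemLp b 2 (specMeasure Sη)) (ha' : MemLp a' 2 (specMeasure SX))
    (hb' : MemLp b' 2 (specMeasure Sη)) :
    specPair ha hb - specPair ha' hb' = specPair (ha.sub ha') (hb.sub hb') := by
  simp only [specPair, ← WithLp.toLp_sub, Prod.mk_sub_mk]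
  rfl

lemma specPair_sum_smul {ι : Type*} (s : Finset ι) (c : ι → ℂ) {u : ι → ℝ → ℂ}
    (hX : ∀ i, MemLp (u i) 2 (specMeasure SX)) (hη : ∀ i, MemLp (u i) 2 (specMeasure Sη))
    (h1 : MemLp (fun f => ∑ i ∈ s, c i * u i f) 2 (specMeasure SX))
    (h2 : MemLp (fun f => ∑ i ∈ s, c i * u i f) 2 (specMeasure Sη)) :
    ∑ i ∈ s, c i • specPair (hX i) (hη i) = specPair h1 h2 := by
  have e1 : ∑ i ∈ s, c i • specPair (hX i) (hη i)
      = WithLp.toLp 2 (∑ i ∈ s, c i • (hX i).toLp (u i), ∑ i ∈ s, c i • (hη i).toLp (u i)) := by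
    classical
    clear h1 h2
    induction s using Finset.induction_on with
    | empty => simp only [Finset.sum_empty]; rfl
    | insert a s ha ih =>
      rw [Finset.sum_insert ha, Finset.sum_insert ha, Finset.sum_insert ha, ih]
      rfl
  rw [e1]
  congr 2
  · exact Lp.ext ((coeFn_sum_smul_toLp s c hX).trans h1.coeFn_toLp.symm)
  · exact Lp.ext ((coeFn_sum_smul_toLp s c hη).trans h2.coeFn_toLp.symm)

/-- The product of a bounded function and a frequency response is a square-integrable symbol. -/
lemma memLp_mul_of_bound {S S' : ℝ → ℝ} (hS : Measurable S) (hSS : ∀ f, S f ≤ S' f)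
    {H : ℝ → ℂ} (hH : Measurable H) (hint : Integrable fun f => S' f * ‖H f‖ ^ 2)
    {φ : ℝ → ℂ} (hφ : Measurable φ) {C : ℝ} (hC : ∀ f, ‖φ f‖ ≤ C) :
    MemLp (fun f => φ f * H f) 2 (specMeasure S) := by
  have h1 : MemLp H 2 (specMeasure S) := by
    refine ⟨hH.aestronglyMeasurable, ?_⟩
    have h := eLpNorm_nnreal_pow_eq_lintegral (μ := specMeasure S) (f := H) (p := 2) (by norm_num)
    have h3 : ∫⁻ x, ‖H x‖ₑ ^ 2 ∂(specMeasure S) < ⊤ := by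
      rw [lintegral_specMeasure hS (by fun_prop)]
      refine lt_of_le_of_lt (lintegral_mono fun f => ?_) hint.lintegral_lt_top
      rw [ENNReal.ofReal_mul' (by positivity), ENNReal.ofReal_pow (norm_nonneg _),
        ofReal_norm]
      gcongr
      exact hSS f
    have h4 : eLpNorm H 2 (specMeasure S) ^ 2 < ⊤ := by
      have : eLpNorm H 2 (specMeasure S) ^ 2 = ∫⁻ x, ‖H x‖ₑ ^ 2 ∂(specMeasure S) := by
        simpa using h
      rw [this]; exact h3
    exact (ENNReal.pow_lt_top_iff.1 h4).resolve_right (by norm_num)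
  refine MemLp.of_le_mul (c := C) h1 (by fun_prop) (Eventually.of_forall fun f => ?_)
  rw [norm_mul]
  gcongr
  exact hC f

end SpectralPair

/-! ### Density of trigonometric polynomials on the circle. -/

section Density

variable {T : ℝ} [Fact (0 < T)]

/-- Trigonometric polynomials are dense in `L²` of every finite measure on the circle. -/
lemma exists_trigPoly_lintegral_lt (ν : Measure (AddCircle T)) [IsFiniteMeasure ν]
    {φ : AddCircle T → ℂ} (hφ : MemLp φ 2 ν) {ε : ℝ} (hε : 0 < ε) :
    ∃ c : ℤ →₀ ℂ, ∫⁻ θ, ‖φ θ - c.sum fun n a => a * fourier n θ‖ₑ ^ 2 ∂ν < ENNReal.ofReal ε := by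
  set u : ℤ → Lp ℂ 2 ν := fun n => ContinuousMap.toLp 2 ν ℂ (fourier n)
  have hd : (Submodule.span ℂ (Set.range u)).topologicalClosure = ⊤ := by
    convert! (ContinuousMap.toLp_denseRange ℂ ν ℂ
      (by norm_num : (2 : ENNReal) ≠ ⊤)).topologicalClosure_map_submodule
      span_fourier_closure_eq_top
    rw [Submodule.map_span, ← Set.range_comp']
    rfl
  have hmem : hφ.toLp φ ∈ (Submodule.span ℂ (Set.range u)).topologicalClosure := hd ▸ trivial
  have hopen : IsOpen {z : Lp ℂ 2 ν | ‖hφ.toLp φ - z‖ ^ 2 < ε} :=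
    isOpen_lt (by fun_prop) (by fun_prop)
  obtain ⟨z, hz, hzs⟩ := mem_closure_iff.1 hmem _ hopen (by simpa using hε)
  obtain ⟨c, rfl⟩ := Finsupp.mem_span_range_iff_exists_finsupp.1 hzs
  refine ⟨c, ?_⟩
  have hf : ∀ n : ℤ, MemLp (fun θ : AddCircle T => fourier n θ) 2 ν := fun n =>
    MemLp.of_bound (fourier n).continuous.aestronglyMeasurable 1
      (Eventually.of_forall fun θ => by rw [fourier_apply]; exact (Circle.norm_coe _).le)
  have hu : ∀ n, u n = (hf n).toLp := fun n => rfl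
  have hc : MemLp (fun θ => c.sum fun n a => a * fourier n θ) 2 ν :=
    memLp_finsetSum _ fun i _ => (hf i).const_mul _
  have he : (c.sum fun i a => a • u i) = hc.toLp :=
    Lp.ext ((coeFn_sum_smul_toLp c.support c hf).trans hc.coeFn_toLp.symm)
  have hz' : ‖hφ.toLp φ - c.sum fun i a => a • u i‖ ^ 2 < ε := hz
  rw [he, ← MemLp.toLp_sub] at hz'
  have := ofReal_norm_toLp_sq (hφ.sub hc)
  simp only [Pi.sub_apply] at this
  rw [← this]
  exact (ENNReal.ofReal_lt_ofReal_iff hε).2 hz'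

end Density

end SubNyquist

namespace SubNyquist

/-! ### The risk of an estimator in the frequency domain. -/

section Risk

/-- The mean-square error, in the spectral domain, of the linear estimator with symbol `ψ` of the
value at time `t` of the source. -/
noncomputable def risk (SX Sη : ℝ → ℝ) (t : ℝ) (ψ : ℝ → ℂ) : ENNReal :=
  ∫⁻ f, (ENNReal.ofReal (SX f) * ‖expSymbol t f - ψ f‖ₑ ^ 2
    + ENNReal.ofReal (Sη f) * ‖ψ f‖ₑ ^ 2)

/-- Applied with `T` the branch sampling frequency and `t` a sampling time: evaluation at a sampling
time is a character of the frequency circle, so the symbols that the samples can produce are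
periodic multiples of the `H p`. -/
lemma expSymbol_eq_fourier {T t : ℝ} (n : ℤ) (ht : t * T = n) (hT : T ≠ 0) (f : ℝ) :
    expSymbol t f = fourier n (f : AddCircle T) := by
  rw [fourier_coe_apply, expSymbol]
  congr 1
  have : (t : ℂ) = n / T := by
    rw [eq_div_iff (by exact_mod_cast hT)]; exact_mod_cast ht
  rw [this]; ring

variable {SX Sη : ℝ → ℝ}

lemma ofReal_norm_expSymbol_sub_sq (hSX : Measurable SX) (hSη : Measurable Sη) {t : ℝ}
    (he : MemLp (expSymbol t) 2 (specMeasure SX)) (h0 : MemLp (0 : ℝ → ℂ) 2 (specMeasure Sη))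
    {ψ : ℝ → ℂ} (hψ : Measurable ψ)
    (h1 : MemLp ψ 2 (specMeasure SX)) (h2 : MemLp ψ 2 (specMeasure Sη)) :
    ENNReal.ofReal (‖specPair he h0 - specPair h1 h2‖ ^ 2) = risk SX Sη t ψ := by
  have := (continuous_expSymbol t).measurable
  rw [specPair_sub, ofReal_norm_specPair_sq hSX hSη (by fun_prop) (by fun_prop)]
  simp [risk]

variable {P : ℕ} {H : Fin P → ℝ → ℂ} {fb : ℝ}

/-- Bounded periodic multiples of a frequency response belong to the closed span of its
modulations. -/
lemma specPair_mem_closure_span [Fact (0 < fb)] (hSX : Measurable SX) (hSη : Measurable Sη)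
    (hSX0 : ∀ f, 0 ≤ SX f) (hSη0 : ∀ f, 0 ≤ Sη f)
    {H : ℝ → ℂ} (hH : Measurable H) (hfin : Integrable fun f => (SX f + Sη f) * ‖H f‖ ^ 2)
    (h1 : ∀ n : ℤ, MemLp (fun f : ℝ => fourier n (f : AddCircle fb) * H f) 2 (specMeasure SX))
    (h2 : ∀ n : ℤ, MemLp (fun f : ℝ => fourier n (f : AddCircle fb) * H f) 2 (specMeasure Sη))
    {φ : AddCircle fb → ℂ} (hφ : Measurable φ) {C : ℝ} (hC : ∀ θ, ‖φ θ‖ ≤ C)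
    (h3 : MemLp (fun f : ℝ => φ f * H f) 2 (specMeasure SX))
    (h4 : MemLp (fun f : ℝ => φ f * H f) 2 (specMeasure Sη)) :
    specPair h3 h4 ∈
      (Submodule.span ℂ (Set.range fun n => specPair (h1 n) (h2 n))).topologicalClosure := by
  set w : ℝ → ENNReal := fun f => ENNReal.ofReal ((SX f + Sη f) * ‖H f‖ ^ 2) with hw
  have hwm : Measurable w := by fun_prop
  have hfinw : IsFiniteMeasure (volume.withDensity w) := isFiniteMeasure_withDensity_ofReal hfin.2
  have hmk : Measurable fun f : ℝ => (f : AddCircle fb) := AddCircle.measurable_mk'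
  -- With the weight `(S_X + S_η)|H|²` pushed to the circle, `φ ↦ φ H` is an isometry from `L²(ν)`
  -- into the joint spectral space. Finite output power makes `ν` finite, so approximating `φ` by
  -- trigonometric polynomials suffices.
  set ν : Measure (AddCircle fb) := (volume.withDensity w).map (fun f : ℝ => (f : AddCircle fb))
  have hν : IsFiniteMeasure ν := Measure.isFiniteMeasure_map _ _
  have hφν : MemLp φ 2 ν := MemLp.of_bound hφ.aestronglyMeasurable C (Eventually.of_forall hC)
  refine Metric.mem_closure_iff.2 fun ε hε => ?_
  obtain ⟨c, hc⟩ := exists_trigPoly_lintegral_lt ν hφν (ε := ε ^ 2) (by positivity)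
  have hcm : Measurable fun θ : AddCircle fb => c.sum fun n a => a * fourier n θ := by
    simp only [Finsupp.sum]
    exact (by fun_prop : Continuous _).measurable
  have h5 : MemLp (fun f : ℝ => ∑ n ∈ c.support, c n * (fourier n (f : AddCircle fb) * H f)) 2
    (specMeasure SX) := memLp_finsetSum _ fun i _ => (h1 i).const_mul _
  have h6 : MemLp (fun f : ℝ => ∑ n ∈ c.support, c n * (fourier n (f : AddCircle fb) * H f)) 2
    (specMeasure Sη) := memLp_finsetSum _ fun i _ => (h2 i).const_mul _
  refine ⟨∑ n ∈ c.support, c n • specPair (h1 n) (h2 n), ?_, ?_⟩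
  · exact Submodule.sum_mem _ fun n _ => Submodule.smul_mem _ _ (Submodule.subset_span ⟨n, rfl⟩)
  rw [specPair_sum_smul c.support c h1 h2 h5 h6, dist_eq_norm,
    ← sq_lt_sq₀ (norm_nonneg _) hε.le, ← ENNReal.ofReal_lt_ofReal_iff (by positivity)]
  refine lt_of_eq_of_lt ?_ hc
  have hfm : ∀ n : ℤ, Measurable fun f : ℝ => fourier n (f : AddCircle fb) := fun n =>
    (fourier n).continuous.measurable.comp hmk
  have hφm : Measurable fun f : ℝ => φ f := hφ.comp hmk
  have hsm : Measurable fun f : ℝ => ∑ n ∈ c.support, c n * (fourier n (f : AddCircle fb) * H f) := by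
    fun_prop
  rw [specPair_sub, ofReal_norm_specPair_sq hSX hSη (by fun_prop) (by fun_prop),
    lintegral_map (by fun_prop) hmk, lintegral_withDensity_eq_lintegral_mul _ hwm
      (by exact ((hφ.sub hcm).comp hmk).enorm.pow_const 2)]
  refine lintegral_congr fun f => ?_
  have e1 : φ f * H f - ∑ n ∈ c.support, c n * (fourier n (f : AddCircle fb) * H f)
      = (φ f - c.sum fun n a => a * fourier n (f : AddCircle fb)) * H f := by
    rw [sub_mul, Finsupp.sum, Finset.sum_mul]
    congr 1
    exact Finset.sum_congr rfl fun n _ => by ring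
  simp only [Pi.sub_apply, Pi.mul_apply, e1, enorm_mul, hw]
  rw [ENNReal.ofReal_mul' (by positivity), ENNReal.ofReal_add (hSX0 f) (hSη0 f),
    ENNReal.ofReal_pow (norm_nonneg _), ofReal_norm]
  ring

end Risk

end SubNyquist

namespace SubNyquist

/-! ### The mean-square error as an infimum of spectral risks. -/

section MMSE

/-- Used to place the separate isometries of source and noise inside the joint one, with `Φ` the
inclusion of a summand. -/
lemma map_mem_spectralGraph {G K K' ι ι' : Type*} [NormedAddCommGroup G] [InnerProductSpace ℝ G]
    [NormedAddCommGroup K] [InnerProductSpace ℂ K] [NormedAddCommGroup K']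
    [InnerProductSpace ℂ K'] {g : ι → G} {k : ι → K} {g' : ι' → G} {k' : ι' → K'}
    (j : ι' → ι) (Φ : K' →L[ℂ] K) (hg : ∀ i, g (j i) = g' i) (hk : ∀ i, k (j i) = Φ (k' i))
    {a : G} {b : K'} (h : (a, b) ∈ spectralGraph g' k') : (a, Φ b) ∈ spectralGraph g k := by
  refine map_mem_closure (f := fun p : G × K' => (p.1, Φ p.2)) (by fun_prop) h ?_
  rintro _ ⟨c, rfl⟩
  refine ⟨c.mapDomain j, ?_⟩
  refine Prod.ext ?_ ?_
  · simp only [combPair]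
    rw [Finsupp.sum_mapDomain_index (by simp) (by intros; rw [add_smul])]
    simp [hg]
  · simp only [combPair]
    rw [Finsupp.sum_mapDomain_index (by simp) (by intros; rw [Complex.ofReal_add, add_smul]),
      map_finsuppSum]
    simp [hk]

variable {Ω : Type*} {m : MeasurableSpace Ω} [mΩ : MeasurableSpace Ω] {μ : Measure Ω}
  {SX Sη : ℝ → ℝ} {X : ℝ → Ω → ℝ} {η : TestFunction Sη → Ω → ℝ}

/-- The element of the spectral Hilbert space that corresponds to `X t` or `η φ`. -/
noncomputable def sourceSymbol (hSX : Integrable SX) :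
    ℝ ⊕ TestFunction Sη → SpecPair SX Sη :=
  Sum.elim (fun t => specPair (memLp_expSymbol hSX t) MemLp.zero)
    (fun φ => specPair MemLp.zero φ.2)

/-- The diagonal blocks are the two covariance formulas. The mixed blocks vanish on both sides: by
independence and centering in `L²(μ)`, and by orthogonality of the summands in the spectral space.
-/
lemma inner_source_eq [IsProbabilityMeasure μ] (hSX_int : Integrable SX) (hSX : Measurable SX) (hSX0 : ∀ f, 0 ≤ SX f)
    (hSη : Measurable Sη) (hSη0 : ∀ f, 0 ≤ Sη f)
    (hX : IsStationaryGaussianProcess μ SX X) (hη : IsStationaryGaussianNoise μ Sη η)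
    (hXη : IndepFun (fun ω t => X t ω) (fun ω φ => η φ ω) μ) (i j : ℝ ⊕ TestFunction Sη) :
    ((inner ℝ (Sum.elim (fun t => (hX.memLp t).toLp (X t)) (fun φ => (hη.memLp φ).toLp (η φ)) i)
      (Sum.elim (fun t => (hX.memLp t).toLp (X t)) (fun φ => (hη.memLp φ).toLp (η φ)) j) : ℝ) : ℂ)
      = inner ℂ (sourceSymbol hSX_int i) (sourceSymbol hSX_int j) := by
  rcases i with i | i <;> rcases j with j | j <;>
    simp only [sourceSymbol, Sum.elim_inl, Sum.elim_inr, WithLp.prod_inner_apply,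
      MemLp.toLp_zero, inner_zero_left, inner_zero_right,
      add_zero, zero_add]
  · exact hX.inner_eq hSX hSX0 (memLp_expSymbol hSX_int) i j
  · exact_mod_cast hX.inner_eq_zero hη hXη i j
  · rw [real_inner_comm]
    exact_mod_cast hX.inner_eq_zero hη hXη j i
  · exact hη.inner_eq hSη hSη0 (fun φ => φ.2) i j

lemma IsNoisyFilterOutput.mem_spectralGraph (hSX_int : Integrable SX)
    (hX : IsStationaryGaussianProcess μ SX X) (hη : IsStationaryGaussianNoise μ Sη η)
    {H : ℝ → ℂ} (hH : Measurable H) {Z : ℝ → Ω → ℝ} (hZ : IsNoisyFilterOutput μ SX Sη X η H Z)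
    (t : ℝ) :
    Measurable (Z t) ∧ ∃ (h1 : MemLp (Z t) 2 μ)
      (h2 : MemLp (fun f => H f * expSymbol t f) 2 (specMeasure SX))
      (h3 : MemLp (fun f => H f * expSymbol t f) 2 (specMeasure Sη)),
      (h1.toLp, specPair h2 h3) ∈ spectralGraph
        (Sum.elim (fun t => (hX.memLp t).toLp (X t)) (fun φ => (hη.memLp φ).toLp (η φ)))
        (sourceSymbol hSX_int) := by
  obtain ⟨U, V, hU, hV, hUV⟩ := hZ
  obtain ⟨u1, u2, hu⟩ := hU.mem_spectralGraph hX (memLp_expSymbol hSX_int) hH t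
  obtain ⟨v1, v2, hv⟩ := hV.mem_spectralGraph hη (fun φ => φ.2) hH t
  have hZt : Z t = U t + V t := funext fun ω => hUV t ω
  refine ⟨hZt ▸ (hU t).1.add (hV t).1, hZt ▸ u1.add v1, u2, v2, ?_⟩
  have hu' := map_mem_spectralGraph (k := sourceSymbol (Sη := Sη) hSX_int)
    (g := Sum.elim (fun t => (hX.memLp t).toLp (X t)) (fun φ => (hη.memLp φ).toLp (η φ)))
    Sum.inl ((WithLp.prodContinuousLinearEquiv 2 ℂ _ _).symm.toContinuousLinearMap ∘L
      ContinuousLinearMap.inl ℂ _ _) (fun _ => rfl) (fun _ => rfl) hu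
  have hv' := map_mem_spectralGraph (k := sourceSymbol (Sη := Sη) hSX_int)
    (g := Sum.elim (fun t => (hX.memLp t).toLp (X t)) (fun φ => (hη.memLp φ).toLp (η φ)))
    Sum.inr ((WithLp.prodContinuousLinearEquiv 2 ℂ _ _).symm.toContinuousLinearMap ∘L
      ContinuousLinearMap.inr ℂ _ _) (fun _ => rfl) (fun _ => rfl) hv
  convert add_mem_spectralGraph hu' hv' using 1
  refine Prod.ext ?_ ?_
  · simp only [Prod.mk_add_mk, ← MemLp.toLp_add]
    congr 1
  · refine (WithLp.toLp_injective 2).eq_iff.2 (Prod.ext ?_ ?_)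
    · exact (add_zero _).symm
    · exact (zero_add _).symm

variable {P : ℕ} {H : Fin P → ℝ → ℂ} {fb : ℝ} {Z : Fin P → ℝ → Ω → ℝ} {Y : Fin P → ℤ → Ω → ℝ}

/-- The mean-square error of the conditional expectation given the samples is the infimum of the
spectral risk over the estimators with periodic symbols. -/
lemma mmse_eq_inf_risk [IsProbabilityMeasure μ] [Fact (0 < fb)]
    (hSX_int : Integrable SX) (hSX : Measurable SX) (hSX0 : ∀ f, 0 ≤ SX f)
    (hSη : Measurable Sη) (hSη0 : ∀ f, 0 ≤ Sη f)
    (hX : IsStationaryGaussianProcess μ SX X) (hη : IsStationaryGaussianNoise μ Sη η)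
    (hXη : IndepFun (fun ω t => X t ω) (fun ω φ => η φ ω) μ)
    (hH : ∀ p, Measurable (H p)) (hfin : ∀ p, Integrable fun f => (SX f + Sη f) * ‖H p f‖ ^ 2)
    (hZ : ∀ p, IsNoisyFilterOutput μ SX Sη X η (H p) (Z p))
    {τ : ℤ → ℝ} (hτ : ∀ n, τ n * fb = n) (hY : ∀ p n, Y p n = Z p (τ n))
    (hm : m = sampleSigma Y) (t : ℝ) :
    (∀ φ : Fin P → AddCircle fb → ℂ, (∀ p, Measurable (φ p)) → ∀ C : ℝ, (∀ p θ, ‖φ p θ‖ ≤ C) →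
      ENNReal.ofReal (∫ ω, (X t ω - (μ[X t | m]) ω) ^ 2 ∂μ)
        ≤ risk SX Sη t fun f => ∑ p, φ p f * H p f) ∧
    (∀ ε > 0, ∃ φ : Fin P → AddCircle fb → ℂ, (∀ p, Measurable (φ p)) ∧
      risk SX Sη t (fun f => ∑ p, φ p f * H p f)
        ≤ ENNReal.ofReal (∫ ω, (X t ω - (μ[X t | m]) ω) ^ 2 ∂μ + ε)) := by
  have hfb : fb ≠ 0 := (Fact.out : 0 < fb).ne'
  set g := Sum.elim (fun t => (hX.memLp t).toLp (X t)) (fun φ => (hη.memLp φ).toLp (η φ)) with hg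
  set E := (Submodule.span ℝ (Set.range g)).topologicalClosure with hE
  have hEg : (E : Set (Lp ℝ 2 μ)) ⊆ gaussianSet μ := hX.span_sum_subset_gaussianSet hη hXη
  have hgram := inner_source_eq hSX_int hSX hSX0 hSη hSη0 hX hη hXη
  have hZt := fun p n => (hZ p).mem_spectralGraph hSX_int hX hη (hH p) (τ n)
  have hYm : ∀ i : Fin P × ℤ, Measurable (Y i.1 i.2) := fun i => hY i.1 i.2 ▸ (hZt i.1 i.2).1
  choose y1 y2 y3 hy using fun (i : Fin P × ℤ) => (hZt i.1 i.2).2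
  set y : Fin P × ℤ → Lp ℝ 2 μ := fun i => (y1 i).toLp with hy_def
  have hsymb : ∀ i : Fin P × ℤ, (fun f => H i.1 f * expSymbol (τ i.2) f)
      = fun f : ℝ => fourier i.2 (f : AddCircle fb) * H i.1 f := fun i => by
    ext f
    rw [expSymbol_eq_fourier i.2 (hτ i.2) hfb, mul_comm]
  have z2 : ∀ i : Fin P × ℤ, MemLp (fun f : ℝ => fourier i.2 (f : AddCircle fb) * H i.1 f) 2
    (specMeasure SX) := fun i => hsymb i ▸ y2 i
  have z3 : ∀ i : Fin P × ℤ, MemLp (fun f : ℝ => fourier i.2 (f : AddCircle fb) * H i.1 f) 2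
    (specMeasure Sη) := fun i => hsymb i ▸ y3 i
  set y' : Fin P × ℤ → SpecPair SX Sη := fun i => specPair (z2 i) (z3 i) with hy'_def
  have hy' : ∀ i, (y i, y' i) ∈ spectralGraph g (sourceSymbol hSX_int) := fun i => by
    have := hy i
    rwa [specPair_congr (y2 i) (y3 i) (z2 i) (z3 i) (hsymb i) (hsymb i)] at this
  set x : Lp ℝ 2 μ := (hX.memLp t).toLp (X t) with hx_def
  set x' : SpecPair SX Sη := specPair (memLp_expSymbol hSX_int t) MemLp.zero with hx'_def
  have hx' : (x, x') ∈ spectralGraph g (sourceSymbol hSX_int) :=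
    mem_spectralGraph_self g (sourceSymbol hSX_int) (Sum.inl t)
  have hxx : ((inner ℝ x x : ℝ) : ℂ) = inner ℂ x' x' :=
    inner_eq_of_mem_spectralGraph hgram hx' hx'
  have hxy : ∀ i, ((inner ℝ x (y i) : ℝ) : ℂ) = inner ℂ x' (y' i) :=
    fun i => inner_eq_of_mem_spectralGraph hgram hx' (hy' i)
  have hyy : ∀ i j, ((inner ℝ (y i) (y j) : ℝ) : ℂ) = inner ℂ (y' i) (y' j) :=
    fun i j => inner_eq_of_mem_spectralGraph hgram (hy' i) (hy' j)
  set F := (Submodule.span ℝ (Set.range y)).topologicalClosure with hF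
  have hd : ∫ ω, (X t ω - (μ[X t | m]) ω) ^ 2 ∂μ = ‖x - F.starProjection x‖ ^ 2 := by
    have hce : μ[x | m] =ᵐ[μ] F.starProjection x :=
      condExp_ae_eq_starProjection (Y := fun i : Fin P × ℤ => Y i.1 i.2) hEg
        (Submodule.isClosed_topologicalClosure _) hYm y
        (fun i => by rw [hY]; exact (y1 i).coeFn_toLp)
        (fun i => fst_mem_of_mem_spectralGraph (hy' i)) (fst_mem_of_mem_spectralGraph hx')
        (by rw [hm, iSup_prod])
    rw [← real_inner_self_eq_norm_sq, L2.inner_def]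
    refine integral_congr_ae ?_
    filter_upwards [hce, condExp_congr_ae (m := m) (hX.memLp t).coeFn_toLp,
      (hX.memLp t).coeFn_toLp, Lp.coeFn_sub x (F.starProjection x)] with ω h1 h2 h3 h4
    rw [h4, Pi.sub_apply, ← h1, h2, h3]
    simp [sq]
  rw [hd]
  constructor
  · intro φ hφ C hC
    have hmk : Measurable fun f : ℝ => (f : AddCircle fb) := AddCircle.measurable_mk'
    have hφm : ∀ p, Measurable fun f : ℝ => φ p f := fun p => (hφ p).comp hmk
    have h3 : ∀ p, MemLp (fun f : ℝ => φ p f * H p f) 2 (specMeasure SX) := fun p =>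
      memLp_mul_of_bound hSX (fun f => le_add_of_nonneg_right (hSη0 f)) (hH p) (hfin p)
        (hφm p) fun f => hC p f
    have h4 : ∀ p, MemLp (fun f : ℝ => φ p f * H p f) 2 (specMeasure Sη) := fun p =>
      memLp_mul_of_bound hSη (fun f => le_add_of_nonneg_left (hSX0 f)) (hH p) (hfin p)
        (hφm p) fun f => hC p f
    have h5 : MemLp (fun f : ℝ => ∑ p, 1 * (φ p f * H p f)) 2 (specMeasure SX) :=
      memLp_finsetSum _ fun p _ => (h3 p).const_mul _
    have h6 : MemLp (fun f : ℝ => ∑ p, 1 * (φ p f * H p f)) 2 (specMeasure Sη) :=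
      memLp_finsetSum _ fun p _ => (h4 p).const_mul _
    have hz : specPair h5 h6 ∈ (Submodule.span ℂ (Set.range y')).topologicalClosure := by
      rw [← specPair_sum_smul Finset.univ (fun _ => 1) h3 h4]
      refine Submodule.sum_mem _ fun p _ => Submodule.smul_mem _ _ ?_
      refine Submodule.topologicalClosure_mono (Submodule.span_mono ?_)
        (specPair_mem_closure_span hSX hSη hSX0 hSη0 (hH p) (hfin p)
          (fun n => z2 (p, n)) (fun n => z3 (p, n)) (hφ p) (hC p) (h3 p) (h4 p))
      rintro _ ⟨n, rfl⟩
      exact ⟨(p, n), rfl⟩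
    have hle := norm_sub_starProjection_le hxx hxy hyy hz
    have hr := ofReal_norm_expSymbol_sub_sq hSX hSη (memLp_expSymbol hSX_int t) MemLp.zero
      (by fun_prop) h5 h6
    have hψ : (fun f : ℝ => ∑ p, φ p f * H p f) = fun f : ℝ => ∑ p, 1 * (φ p f * H p f) := by
      simp only [one_mul]
    rw [hψ, ← hr]
    exact ENNReal.ofReal_le_ofReal (pow_le_pow_left₀ (norm_nonneg _) hle 2)
  · intro ε hε
    obtain ⟨c, hc⟩ := exists_norm_sub_sq_lt hxx hxy hyy hε
    -- The near-optimal combination of samples, grouped by branch: the terms of branch `p` form one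
    -- trigonometric polynomial multiplying `H p`.
    refine ⟨fun p θ => ∑ i ∈ c.support, if i.1 = p then c i * fourier i.2 θ else 0,
      fun p => ?_, ?_⟩
    · refine Finset.measurable_fun_sum _ fun i _ => ?_
      split_ifs
      · exact ((fourier i.2).continuous.measurable).const_mul _
      · exact measurable_const
    have h5 : MemLp (fun f : ℝ => ∑ i ∈ c.support, c i * (fourier i.2 (f : AddCircle fb) * H i.1 f))
      2 (specMeasure SX) := memLp_finsetSum _ fun i _ => (z2 i).const_mul _
    have h6 : MemLp (fun f : ℝ => ∑ i ∈ c.support, c i * (fourier i.2 (f : AddCircle fb) * H i.1 f))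
      2 (specMeasure Sη) := memLp_finsetSum _ fun i _ => (z3 i).const_mul _
    have hmk : Measurable fun f : ℝ => (f : AddCircle fb) := AddCircle.measurable_mk'
    have hfm : ∀ n : ℤ, Measurable fun f : ℝ => fourier n (f : AddCircle fb) := fun n =>
      (fourier n).continuous.measurable.comp hmk
    have hr := ofReal_norm_expSymbol_sub_sq hSX hSη (memLp_expSymbol hSX_int t) MemLp.zero
      (by fun_prop) h5 h6
    have hψ : (fun f : ℝ => ∑ p, (∑ i ∈ c.support,
        if i.1 = p then c i * fourier i.2 (f : AddCircle fb) else 0) * H p f)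
        = fun f : ℝ => ∑ i ∈ c.support, c i * (fourier i.2 (f : AddCircle fb) * H i.1 f) := by
      ext f
      simp only [Finset.sum_mul]
      rw [Finset.sum_comm]
      refine Finset.sum_congr rfl fun i _ => ?_
      simp [ite_mul, mul_assoc]
    rw [hψ, ← hr, ← specPair_sum_smul c.support c z2 z3]
    exact ENNReal.ofReal_le_ofReal hc.le

end MMSE

end SubNyquist

namespace SubNyquist

/-! ### Pseudo-inverses and degenerate quadratic minimisation. -/

section PseudoInverse

open scoped ComplexOrder

variable {P : ℕ}

/-- The Moore–Penrose inverse of a positive semidefinite matrix. -/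
noncomputable def pinv (A : Matrix (Fin P) (Fin P) ℂ) : Matrix (Fin P) (Fin P) ℂ :=
  invSqrt A * invSqrt A

lemma isHermitian_invSqrt (A : Matrix (Fin P) (Fin P) ℂ) : (invSqrt A).IsHermitian :=
  cfc_predicate (p := IsSelfAdjoint) _ A

lemma continuousOn_spectrum (A : Matrix (Fin P) (Fin P) ℂ) (g : ℝ → ℝ) :
    ContinuousOn g (spectrum ℝ A) :=
  (Matrix.finite_real_spectrum (A := A)).continuousOn g

lemma nonneg_of_mem_spectrum {A : Matrix (Fin P) (Fin P) ℂ} (hA : A.PosSemidef) {x : ℝ}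
    (hx : x ∈ spectrum ℝ A) : 0 ≤ x := by
  rw [hA.1.spectrum_real_eq_range_eigenvalues] at hx
  obtain ⟨i, rfl⟩ := hx
  exact hA.eigenvalues_nonneg i

/-- Positivity is needed because `Real.sqrt` sends negative numbers to `0`. The convention `0⁻¹ = 0`
makes this the inverse on the range and zero on the kernel. -/
lemma pinv_eq_cfc {A : Matrix (Fin P) (Fin P) ℂ} (hA : A.PosSemidef) :
    pinv A = cfc (fun x : ℝ => x⁻¹) A := by
  rw [pinv, invSqrt, ← cfc_mul _ _ A (continuousOn_spectrum A _) (continuousOn_spectrum A _)]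
  refine cfc_congr fun x hx => ?_
  simp only [← mul_inv, Real.mul_self_sqrt (nonneg_of_mem_spectrum hA hx)]

lemma mul_pinv_mul {A : Matrix (Fin P) (Fin P) ℂ} (hA : A.PosSemidef) : A * pinv A * A = A := by
  have hA' : IsSelfAdjoint A := hA.1
  rw [pinv_eq_cfc hA]
  nth_rw 1 3 4 [← cfc_id' ℝ A]
  rw [← cfc_mul _ _ A (continuousOn_spectrum A _) (continuousOn_spectrum A _),
    ← cfc_mul _ _ A (continuousOn_spectrum A _) (continuousOn_spectrum A _)]
  refine cfc_congr fun x _ => ?_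
  by_cases hx : x = 0
  · simp [hx]
  · simp [hx]

lemma pinv_mul_comm {A : Matrix (Fin P) (Fin P) ℂ} (hA : A.PosSemidef) :
    A * pinv A = pinv A * A := by
  have hA' : IsSelfAdjoint A := hA.1
  rw [pinv_eq_cfc hA]
  nth_rw 1 4 [← cfc_id' ℝ A]
  exact (cfc_commute_cfc _ _ A).eq

lemma inv_mul_eq_cfc {A : Matrix (Fin P) (Fin P) ℂ} (hA : A.IsHermitian) {ε : ℝ} (hε : 0 < ε) :
    (A * A + (ε : ℂ) • 1)⁻¹ * A = cfc (fun x : ℝ => (x * x + ε)⁻¹ * x) A := by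
  have hA' : IsSelfAdjoint A := hA
  have h1 : A * A + (ε : ℂ) • 1 = cfc (fun x : ℝ => x * x + ε) A := by
    rw [cfc_add_const ε _ A (continuousOn_spectrum A _),
      cfc_mul _ _ A (continuousOn_spectrum A _) (continuousOn_spectrum A _), cfc_id' ℝ A]
    congr 1
    ext i j
    simp [Matrix.algebraMap_eq_diagonal, Matrix.smul_apply, Matrix.one_apply, Matrix.diagonal]
  have h2 : (A * A + (ε : ℂ) • 1) * cfc (fun x : ℝ => (x * x + ε)⁻¹) A = 1 := by
    rw [h1, ← cfc_mul _ _ A (continuousOn_spectrum A _) (continuousOn_spectrum A _),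
      ← cfc_const_one ℝ A]
    refine cfc_congr fun x _ => ?_
    have : x * x + ε ≠ 0 := by nlinarith [mul_self_nonneg x]
    simp [this]
  rw [Matrix.inv_eq_right_inv h2, cfc_mul _ _ A (continuousOn_spectrum A _)
    (continuousOn_spectrum A _), cfc_id' ℝ A]

/-- Tikhonov regularisation: `λ/(λ² + ε)` tends to `1/λ` if `λ ≠ 0` and is `0` if `λ = 0`. The
pseudo-inverse is discontinuous in `A`, so its measurability is obtained through these regular
approximations. -/
lemma tendsto_pinv {A : Matrix (Fin P) (Fin P) ℂ} (hA : A.PosSemidef) :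
    Tendsto (fun n : ℕ => (A * A + ((1 / (n + 1) : ℝ) : ℂ) • 1)⁻¹ * A) atTop (𝓝 (pinv A)) := by
  have h1 : ∀ n : ℕ, (A * A + ((1 / (n + 1) : ℝ) : ℂ) • 1)⁻¹ * A
      = cfc (fun x : ℝ => (x * x + 1 / (n + 1))⁻¹ * x) A := fun n =>
    inv_mul_eq_cfc hA.1 (by positivity)
  simp only [h1, pinv_eq_cfc hA, hA.1.cfc_eq, Matrix.IsHermitian.cfc,
    Unitary.conjStarAlgAut_apply]
  refine Tendsto.mul_const _ (Tendsto.const_mul _ ?_)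
  refine (Continuous.matrix_diagonal continuous_id).continuousAt.tendsto.comp ?_
  rw [tendsto_pi_nhds]
  intro i
  refine (Complex.continuous_ofReal.tendsto _).comp ?_
  simp only [Function.comp_apply]
  set x := hA.1.eigenvalues i
  by_cases hx : x = 0
  · simp [hx]
  · have h2 : Tendsto (fun n : ℕ => (x * x + 1 / ((n : ℝ) + 1))⁻¹ * x) atTop
        (𝓝 ((x * x + 0)⁻¹ * x)) :=
      Tendsto.mul_const _ (Tendsto.inv₀
        (tendsto_const_nhds.add tendsto_one_div_add_atTop_nhds_zero_nat) (by simpa using hx))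
    have h3 : (x * x + 0)⁻¹ * x = x⁻¹ := by field_simp; simp
    rw [h3] at h2
    exact h2

lemma measurable_comp_matrix {α : Type*} [MeasurableSpace α] {n : Type*} [Fintype n]
    {G : Matrix n n ℂ → ℂ}
    (hG : Continuous G) {A : α → Matrix n n ℂ} (hA : ∀ i j, Measurable fun a => A a i j) :
    Measurable fun a => G (A a) := by
  have hG' : Continuous (fun x : n → n → ℂ => G (Matrix.of x)) := hG
  exact hG'.measurable.comp (measurable_pi_lambda _ fun i => measurable_pi_lambda _ fun j => hA i j)

/-- By Cramer's rule the entries are polynomials in the entries of `A` and their conjugate-free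
determinant, divided by that determinant. -/
lemma measurable_inv_mul {α : Type*} [MeasurableSpace α] {A : α → Matrix (Fin P) (Fin P) ℂ}
    (hA : ∀ i j, Measurable fun a => A a i j) (ε : ℂ) (i j : Fin P) :
    Measurable fun a => ((A a * A a + ε • 1)⁻¹ * A a) i j := by
  have h1 : ∀ M : Matrix (Fin P) (Fin P) ℂ, ((M * M + ε • 1)⁻¹ * M) i j
      = (M * M + ε • 1).det⁻¹ * ((M * M + ε • 1).adjugate * M) i j := fun M => by
    rw [Matrix.inv_def, Ring.inverse_eq_inv', Matrix.smul_mul, Matrix.smul_apply, smul_eq_mul]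
  simp only [h1]
  refine Measurable.mul (Measurable.inv ?_) ?_
  · exact measurable_comp_matrix (G := fun M => (M * M + ε • 1).det) (by fun_prop) hA
  · refine measurable_comp_matrix (G := fun M => ((M * M + ε • 1).adjugate * M) i j) ?_ hA
    have : Continuous fun M : Matrix (Fin P) (Fin P) ℂ => (M * M + ε • 1).adjugate * M := by
      fun_prop
    exact this.matrix_elem i j

/-- The entries of the pseudo-inverse of a measurable family of matrices are almost everywhere
measurable. -/
lemma aemeasurable_pinv {α : Type*} [MeasurableSpace α] {ν : Measure α}
    {A : α → Matrix (Fin P) (Fin P) ℂ} (hA : ∀ i j, Measurable fun a => A a i j)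
    (hpos : ∀ᵐ a ∂ν, (A a).PosSemidef) (i j : Fin P) :
    AEMeasurable (fun a => pinv (A a) i j) ν := by
  refine aemeasurable_of_tendsto_metrizable_ae atTop
    (fun n : ℕ => (measurable_inv_mul hA ((1 / (n + 1) : ℝ) : ℂ) i j).aemeasurable) ?_
  filter_upwards [hpos] with a ha
  have := tendsto_pinv ha
  exact (tendsto_pi_nhds.1 ((tendsto_pi_nhds.1 this) i)) j

section Quadratic

variable {A : Matrix (Fin P) (Fin P) ℂ} {v : Fin P → ℂ} {s : ℝ}

/-- Along a kernel direction the quadratic part is absent, so a nonzero linear part would drive the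
expression below zero. -/
lemma star_dotProduct_eq_zero_of_mulVec_eq_zero
    (hq : ∀ x : Fin P → ℂ, 0 ≤ s - 2 * (star x ⬝ᵥ v).re + (star x ⬝ᵥ A *ᵥ x).re)
    {x : Fin P → ℂ} (hx : A *ᵥ x = 0) : star x ⬝ᵥ v = 0 := by
  by_contra hne
  have hpos : 0 < ‖star x ⬝ᵥ v‖ ^ 2 := by positivity
  -- The multiple of `x` at which the linear part equals `s + 1`: the expression is then `s - 2(s +
  -- 1) = -s - 2`, negative since `hq 0` gives `s ≥ 0`.
  have h := hq ((((s + 1) / ‖star x ⬝ᵥ v‖ ^ 2 : ℝ) * (star x ⬝ᵥ v)) • x)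
  rw [Matrix.mulVec_smul, hx, smul_zero, dotProduct_zero, star_smul, smul_dotProduct,
    smul_eq_mul] at h
  have h2 : (star (((s + 1) / ‖star x ⬝ᵥ v‖ ^ 2 : ℝ) * (star x ⬝ᵥ v)) * (star x ⬝ᵥ v)).re
      = s + 1 := by
    have : star (((s + 1) / ‖star x ⬝ᵥ v‖ ^ 2 : ℝ) * (star x ⬝ᵥ v)) * (star x ⬝ᵥ v)
        = (((s + 1) / ‖star x ⬝ᵥ v‖ ^ 2 * ‖star x ⬝ᵥ v‖ ^ 2 : ℝ) : ℂ) := by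
      rw [star_mul', mul_assoc]
      rw [show star (star x ⬝ᵥ v) * (star x ⬝ᵥ v) = ((‖star x ⬝ᵥ v‖ ^ 2 : ℝ) : ℂ) by
        rw [Complex.star_def, Complex.conj_mul']; push_cast; rfl]
      rw [Complex.star_def, Complex.conj_ofReal, ← Complex.ofReal_mul]
    rw [this, Complex.ofReal_re, div_mul_cancel₀ _ hpos.ne']
  have hs := hq 0
  simp at hs
  rw [h2] at h
  simp at h
  linarith

/-- The defect `w` lies in the kernel of `A`, so it is orthogonal to `v` by the previous lemma and
to the range of `A` by symmetry. Being a difference of two such vectors, it is orthogonal to itself.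
-/
lemma mulVec_pinv_mulVec (hA : A.PosSemidef)
    (hq : ∀ x : Fin P → ℂ, 0 ≤ s - 2 * (star x ⬝ᵥ v).re + (star x ⬝ᵥ A *ᵥ x).re) :
    A *ᵥ (pinv A *ᵥ v) = v := by
  set w := v - A *ᵥ (pinv A *ᵥ v) with hw
  have hAw : A *ᵥ w = 0 := by
    rw [hw, Matrix.mulVec_sub, Matrix.mulVec_mulVec v A, pinv_mul_comm hA,
      Matrix.mulVec_mulVec, ← Matrix.mul_assoc, mul_pinv_mul hA, sub_self]
  have h0 := star_dotProduct_eq_zero_of_mulVec_eq_zero hq hAw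
  have h1 : star w ⬝ᵥ w = 0 := by
    conv_lhs => rw [hw, dotProduct_sub, h0, zero_sub]
    rw [Matrix.dotProduct_mulVec, ← hw]
    have : star w ᵥ* A = 0 := by
      have := congrArg star hAw
      rwa [Matrix.star_mulVec, hA.1.eq, star_zero] at this
    rw [this, zero_dotProduct, neg_zero]
  have h2 : w = 0 := dotProduct_star_self_eq_zero.1 h1
  exact (sub_eq_zero.1 h2).symm

lemma re_star_dotProduct_comm (x y : Fin P → ℂ) : (star x ⬝ᵥ y).re = (star y ⬝ᵥ x).re := by
  rw [← star_star y, Matrix.star_dotProduct_star, star_star, Complex.star_def, Complex.conj_re]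

/-- Completing the square. -/
lemma quadratic_eq (hA : A.PosSemidef)
    (hq : ∀ x : Fin P → ℂ, 0 ≤ s - 2 * (star x ⬝ᵥ v).re + (star x ⬝ᵥ A *ᵥ x).re)
    (x : Fin P → ℂ) :
    s - 2 * (star x ⬝ᵥ v).re + (star x ⬝ᵥ A *ᵥ x).re
      = s - (star v ⬝ᵥ pinv A *ᵥ v).re
        + (star (x - pinv A *ᵥ v) ⬝ᵥ A *ᵥ (x - pinv A *ᵥ v)).re := by
  have hAw := mulVec_pinv_mulVec hA hq
  set w := pinv A *ᵥ v with hw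
  have h1 : star w ⬝ᵥ A *ᵥ x = star v ⬝ᵥ x := by
    rw [Matrix.dotProduct_mulVec]
    congr 1
    conv_rhs => rw [← hAw, Matrix.star_mulVec, hA.1.eq]
  rw [star_sub, Matrix.mulVec_sub, hAw, dotProduct_sub, sub_dotProduct, sub_dotProduct, h1]
  simp only [Complex.sub_re]
  rw [re_star_dotProduct_comm v x, re_star_dotProduct_comm w v]
  ring

lemma pinv_quadratic_nonneg (hA : A.PosSemidef)
    (hq : ∀ x : Fin P → ℂ, 0 ≤ s - 2 * (star x ⬝ᵥ v).re + (star x ⬝ᵥ A *ᵥ x).re) :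
    (star (pinv A *ᵥ v) ⬝ᵥ A *ᵥ (pinv A *ᵥ v)).re = (star v ⬝ᵥ pinv A *ᵥ v).re ∧
    0 ≤ (star v ⬝ᵥ pinv A *ᵥ v).re ∧ (star v ⬝ᵥ pinv A *ᵥ v).re ≤ s := by
  have h1 : (star (pinv A *ᵥ v) ⬝ᵥ A *ᵥ (pinv A *ᵥ v)).re = (star v ⬝ᵥ pinv A *ᵥ v).re := by
    rw [mulVec_pinv_mulVec hA hq, re_star_dotProduct_comm]
  refine ⟨h1, ?_, ?_⟩
  · rw [← h1]
    exact (Complex.nonneg_iff.1 (hA.dotProduct_mulVec_nonneg _)).1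
  · have h2 := hq (pinv A *ᵥ v)
    rw [quadratic_eq hA hq] at h2
    simpa using h2

end Quadratic

end PseudoInverse

end SubNyquist

namespace SubNyquist

/-! ### Folding integrals over the line onto one band. -/

section Periodization

variable {fb : ℝ}

/-- The fundamental frequency band. -/
abbrev band (fb : ℝ) : Set ℝ := Set.Ioc (-(fb / 2)) (fb / 2)

/-- The half-open band is a fundamental domain for translation by multiples of `fb`. -/
lemma lintegral_eq_lintegral_band (hfb : 0 < fb) {F : ℝ → ENNReal} (hF : Measurable F) :
    ∫⁻ f, F f = ∫⁻ f in band fb, ∑' k : ℤ, F (f - fb * k) := by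
  have hb : band fb = Set.Ioc (-(fb / 2)) (-(fb / 2) + fb) := by
    rw [band]; congr 1; ring
  have hdom := isAddFundamentalDomain_Ioc hfb (-(fb / 2))
  rw [← hb] at hdom
  rw [lintegral_tsum fun k => by fun_prop, hdom.lintegral_eq_tsum' F]
  have hbij : Function.Bijective (fun k : ℤ => (⟨k • fb, k, rfl⟩ : AddSubgroup.zmultiples fb)) := by
    constructor
    · intro a b hab
      simpa [hfb.ne'] using hab
    · rintro ⟨_, k, rfl⟩
      exact ⟨k, rfl⟩
  rw [← (Equiv.ofBijective _ hbij).tsum_eq]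
  refine tsum_congr fun k => ?_
  refine lintegral_congr fun f => ?_
  congr 1
  change -(k • fb) + f = _
  rw [zsmul_eq_mul]; ring

lemma ae_summable_band (hfb : 0 < fb) {F : ℝ → ℝ} (hFm : Measurable F) (hF0 : ∀ f, 0 ≤ F f)
    (hF : Integrable F) :
    ∀ᵐ f ∂(volume.restrict (band fb)), Summable fun k : ℤ => F (f - fb * k) := by
  have h := hF.lintegral_lt_top
  rw [lintegral_eq_lintegral_band hfb (by fun_prop)] at h
  have hm : Measurable fun f => ∑' k : ℤ, ENNReal.ofReal (F (f - fb * k)) :=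
    Measurable.tsum fun k => by fun_prop
  filter_upwards [ae_lt_top hm h.ne] with f hf
  have := ENNReal.summable_toReal hf.ne
  simpa only [ENNReal.toReal_ofReal (hF0 _)] using this

lemma integrable_tsum_band (hfb : 0 < fb) {F : ℝ → ℝ} (hFm : Measurable F) (hF0 : ∀ f, 0 ≤ F f)
    (hF : Integrable F) :
    Integrable (fun f => ∑' k : ℤ, F (f - fb * k)) (volume.restrict (band fb)) ∧
      ∫ f in band fb, ∑' k : ℤ, F (f - fb * k) = ∫ f, F f := by
  have hm : Measurable fun f => ∑' k : ℤ, F (f - fb * k) :=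
    Measurable.tsum fun k => by fun_prop
  have hl : ∫⁻ f in band fb, ENNReal.ofReal (∑' k : ℤ, F (f - fb * k))
      = ∫⁻ f, ENNReal.ofReal (F f) := by
    rw [lintegral_eq_lintegral_band hfb (by fun_prop)]
    refine lintegral_congr_ae ?_
    filter_upwards [ae_summable_band hfb hFm hF0 hF] with f hf
    exact ENNReal.ofReal_tsum_of_nonneg (fun k => hF0 _) hf
  have h0 : ∀ f, 0 ≤ ∑' k : ℤ, F (f - fb * k) := fun f => tsum_nonneg fun k => hF0 _
  refine ⟨⟨hm.aestronglyMeasurable, ?_⟩, ?_⟩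
  · rw [hasFiniteIntegral_iff_ofReal (Eventually.of_forall h0), hl]
    exact hF.lintegral_lt_top
  · rw [integral_eq_lintegral_of_nonneg_ae (Eventually.of_forall h0) hm.aestronglyMeasurable, hl,
      ← integral_eq_lintegral_of_nonneg_ae (Eventually.of_forall hF0) hFm.aestronglyMeasurable]

end Periodization

/-! ### The aliased risk as a quadratic form at each frequency. -/

section Aliasing

open scoped ComplexOrder

variable {P : ℕ} {SX Sη : ℝ → ℝ} {H : Fin P → ℝ → ℂ} {fb : ℝ}

/-- The cross-spectral vector `∑_k {S_X H_p^* e^{2πit·}}(f - f_b k)`. -/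
noncomputable def crossVec (SX : ℝ → ℝ) (H : Fin P → ℝ → ℂ) (fb t f : ℝ) : Fin P → ℂ :=
  fun p => ∑' k : ℤ, (SX (f - fb * k) : ℂ) * conj (H p (f - fb * k)) * expSymbol t (f - fb * k)

/-- The aliased source density `∑_k S_X(f - f_b k)`. -/
noncomputable def aliasSum (SX : ℝ → ℝ) (fb f : ℝ) : ℝ := ∑' k : ℤ, SX (f - fb * k)

/-- The mean-square of the optimal estimator of the source at time `t`, per unit of frequency. -/
noncomputable def gain (SX Sη : ℝ → ℝ) (H : Fin P → ℝ → ℂ) (fb t f : ℝ) : ℝ :=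
  (star (crossVec SX H fb t f) ⬝ᵥ
    pinv (sampledPSD SX Sη H fb f) *ᵥ crossVec SX H fb t f).re

/-- The frequencies at which the aliased densities converge. -/
structure IsRegularFreq (SX Sη : ℝ → ℝ) (H : Fin P → ℝ → ℂ) (fb f : ℝ) : Prop where
  source : Summable fun k : ℤ => SX (f - fb * k)
  branch : ∀ p, Summable fun k : ℤ =>
    (SX (f - fb * k) + Sη (f - fb * k)) * ‖H p (f - fb * k)‖ ^ 2

lemma ae_isRegularFreq (hfb : 0 < fb) (hSX_int : Integrable SX) (hSX : Measurable SX)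
    (hSX0 : ∀ f, 0 ≤ SX f) (hSη : Measurable Sη) (hSη0 : ∀ f, 0 ≤ Sη f)
    (hH : ∀ p, Measurable (H p)) (hfin : ∀ p, Integrable fun f => (SX f + Sη f) * ‖H p f‖ ^ 2) :
    ∀ᵐ f ∂(volume.restrict (band fb)), IsRegularFreq SX Sη H fb f := by
  have h1 := ae_summable_band hfb hSX hSX0 hSX_int
  have h2 : ∀ p, ∀ᵐ f ∂(volume.restrict (band fb)), Summable fun k : ℤ =>
      (SX (f - fb * k) + Sη (f - fb * k)) * ‖H p (f - fb * k)‖ ^ 2 := fun p => by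
    have := hH p
    exact ae_summable_band hfb (F := fun f => (SX f + Sη f) * ‖H p f‖ ^ 2) (by fun_prop)
      (fun f => mul_nonneg (add_nonneg (hSX0 f) (hSη0 f)) (by positivity)) (hfin p)
  filter_upwards [h1, ae_all_iff.2 h2] with f hf1 hf2 using ⟨hf1, hf2⟩

lemma isHermitian_sampledPSD (f : ℝ) : (sampledPSD SX Sη H fb f).IsHermitian := by
  ext i j
  rw [Matrix.conjTranspose_apply, sampledPSD, Matrix.of_apply, Matrix.of_apply,
    Complex.star_def, Complex.conj_tsum]
  refine tsum_congr fun k => ?_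
  simp only [map_mul, Complex.conj_ofReal, Complex.conj_conj]
  ring

variable {f : ℝ}

/-- From `|H| ≤ 1 + |H|²`, the terms are dominated by those of the source series plus those of the
branch series. -/
lemma IsRegularFreq.summable_crossVec (hf : IsRegularFreq SX Sη H fb f)
    (hSX0 : ∀ f, 0 ≤ SX f) (hSη0 : ∀ f, 0 ≤ Sη f) (t : ℝ) (p : Fin P) :
    Summable fun k : ℤ =>
      (SX (f - fb * k) : ℂ) * conj (H p (f - fb * k)) * expSymbol t (f - fb * k) := by
  refine Summable.of_norm_bounded (hf.source.add (hf.branch p)) fun k => ?_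
  set x := f - fb * k
  rw [norm_mul, norm_mul, norm_expSymbol, mul_one, Complex.norm_conj, Complex.norm_real,
    Real.norm_of_nonneg (hSX0 x)]
  have h1 := hSX0 x
  have h2 := hSη0 x
  nlinarith [mul_nonneg h1 (sq_nonneg (‖H p x‖ - 1)), mul_nonneg h2 (sq_nonneg ‖H p x‖)]

lemma IsRegularFreq.summable_sampledPSD (hf : IsRegularFreq SX Sη H fb f)
    (hSX0 : ∀ f, 0 ≤ SX f) (hSη0 : ∀ f, 0 ≤ Sη f) (i j : Fin P) :
    Summable fun k : ℤ => ((SX (f - fb * k) + Sη (f - fb * k) : ℝ) : ℂ)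
      * conj (H i (f - fb * k)) * H j (f - fb * k) := by
  refine Summable.of_norm_bounded ((hf.branch i).add (hf.branch j)) fun k => ?_
  set x := f - fb * k
  have h1 : 0 ≤ SX x + Sη x := add_nonneg (hSX0 x) (hSη0 x)
  rw [norm_mul, norm_mul, Complex.norm_conj, Complex.norm_real, Real.norm_of_nonneg h1]
  nlinarith [mul_nonneg h1 (sq_nonneg (‖H i x‖ - ‖H j x‖)),
    mul_nonneg h1 (sq_nonneg ‖H i x‖), mul_nonneg h1 (sq_nonneg ‖H j x‖)]

/-- Each term of the series defining the matrix is a nonnegative scalar times a rank-one form. -/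
lemma IsRegularFreq.hasSum_quadratic (hf : IsRegularFreq SX Sη H fb f)
    (hSX0 : ∀ f, 0 ≤ SX f) (hSη0 : ∀ f, 0 ≤ Sη f) (x : Fin P → ℂ) :
    HasSum (fun k : ℤ => (SX (f - fb * k) + Sη (f - fb * k)) * ‖∑ p, x p * H p (f - fb * k)‖ ^ 2)
      (star x ⬝ᵥ sampledPSD SX Sη H fb f *ᵥ x).re := by
  have h1 : HasSum (fun k : ℤ => ∑ i, ∑ j, star (x i) * ((((SX (f - fb * k) + Sη (f - fb * k) : ℝ)
      : ℂ) * conj (H i (f - fb * k)) * H j (f - fb * k)) * x j))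
      (star x ⬝ᵥ sampledPSD SX Sη H fb f *ᵥ x) := by
    simp only [dotProduct, Matrix.mulVec, Finset.mul_sum]
    refine hasSum_sum fun i _ => hasSum_sum fun j _ => ?_
    exact ((hf.summable_sampledPSD hSX0 hSη0 i j).hasSum.mul_right _).mul_left _
  refine Eq.mpr (congrArg (fun g => HasSum g _) (funext fun k => ?_)) (Complex.reCLM.hasSum h1)
  set z := f - fb * k
  have h2 : ∑ i, ∑ j, star (x i) * (((SX z + Sη z : ℝ) : ℂ) * conj (H i z) * H j z * x j)
      = ((SX z + Sη z : ℝ) : ℂ) * (conj (∑ p, x p * H p z) * ∑ p, x p * H p z) := by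
    rw [map_sum, Finset.sum_mul_sum, Finset.mul_sum]
    refine Finset.sum_congr rfl fun i _ => ?_
    rw [Finset.mul_sum]
    refine Finset.sum_congr rfl fun j _ => ?_
    rw [map_mul, Complex.star_def]; ring
  rw [h2, Complex.conj_mul', ← Complex.ofReal_pow, ← Complex.ofReal_mul]
  rfl

lemma IsRegularFreq.hasSum_crossVec (hf : IsRegularFreq SX Sη H fb f)
    (hSX0 : ∀ f, 0 ≤ SX f) (hSη0 : ∀ f, 0 ≤ Sη f) (t : ℝ) (x : Fin P → ℂ) :
    HasSum (fun k : ℤ => SX (f - fb * k) *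
      (conj (∑ p, x p * H p (f - fb * k)) * expSymbol t (f - fb * k)).re)
      (star x ⬝ᵥ crossVec SX H fb t f).re := by
  have h1 : HasSum (fun k : ℤ => ∑ i, star (x i) * ((SX (f - fb * k) : ℂ)
      * conj (H i (f - fb * k)) * expSymbol t (f - fb * k)))
      (star x ⬝ᵥ crossVec SX H fb t f) := by
    simp only [dotProduct]
    refine hasSum_sum fun i _ => ?_
    exact (hf.summable_crossVec hSX0 hSη0 t i).hasSum.mul_left _
  refine Eq.mpr (congrArg (fun g => HasSum g _) (funext fun k => ?_)) (Complex.reCLM.hasSum h1)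
  set z := f - fb * k
  have h2 : ∑ i, star (x i) * ((SX z : ℂ) * conj (H i z) * expSymbol t z)
      = (SX z : ℂ) * (conj (∑ p, x p * H p z) * expSymbol t z) := by
    rw [map_sum, Finset.sum_mul, Finset.mul_sum]
    refine Finset.sum_congr rfl fun i _ => ?_
    rw [map_mul, Complex.star_def]; ring
  rw [h2, Complex.reCLM_apply, Complex.re_ofReal_mul]

/-- The spectral risk density at the frequencies aliased to `f` is a quadratic function of the
value of the symbol. -/
lemma IsRegularFreq.hasSum_risk (hf : IsRegularFreq SX Sη H fb f)
    (hSX0 : ∀ f, 0 ≤ SX f) (hSη0 : ∀ f, 0 ≤ Sη f) (t : ℝ) (x : Fin P → ℂ) :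
    HasSum (fun k : ℤ => SX (f - fb * k) *
        ‖expSymbol t (f - fb * k) - ∑ p, x p * H p (f - fb * k)‖ ^ 2
        + Sη (f - fb * k) * ‖∑ p, x p * H p (f - fb * k)‖ ^ 2)
      (aliasSum SX fb f - 2 * (star x ⬝ᵥ crossVec SX H fb t f).re
        + (star x ⬝ᵥ sampledPSD SX Sη H fb f *ᵥ x).re) := by
  refine Eq.mpr (congrArg (fun g => HasSum g _) (funext fun k => ?_))
    ((hf.source.hasSum.sub ((hf.hasSum_crossVec hSX0 hSη0 t x).mul_left 2)).add
      (hf.hasSum_quadratic hSX0 hSη0 x))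
  set z := f - fb * k
  set y := ∑ p, x p * H p z
  have h1 : ‖expSymbol t z - y‖ ^ 2
      = 1 - 2 * (conj y * expSymbol t z).re + ‖y‖ ^ 2 := by
    rw [Complex.sq_norm, Complex.normSq_sub, ← Complex.sq_norm, ← Complex.sq_norm,
      norm_expSymbol, mul_comm (conj y)]
    ring
  rw [h1]; ring

lemma IsRegularFreq.posSemidef (hf : IsRegularFreq SX Sη H fb f)
    (hSX0 : ∀ f, 0 ≤ SX f) (hSη0 : ∀ f, 0 ≤ Sη f) : (sampledPSD SX Sη H fb f).PosSemidef := by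
  refine .of_dotProduct_mulVec_nonneg (isHermitian_sampledPSD f) fun x => ?_
  rw [Complex.nonneg_iff]
  refine ⟨(hf.hasSum_quadratic hSX0 hSη0 x).nonneg fun k =>
    mul_nonneg (add_nonneg (hSX0 _) (hSη0 _)) (by positivity), ?_⟩
  exact ((isHermitian_sampledPSD f).im_star_dotProduct_mulVec_self x).symm

/-- This supplies the hypothesis `hq` of the minimisation lemmas, and with it the solvability of the
normal equations when the matrix is singular. -/
lemma IsRegularFreq.quadratic_nonneg (hf : IsRegularFreq SX Sη H fb f)
    (hSX0 : ∀ f, 0 ≤ SX f) (hSη0 : ∀ f, 0 ≤ Sη f) (t : ℝ) (x : Fin P → ℂ) :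
    0 ≤ aliasSum SX fb f - 2 * (star x ⬝ᵥ crossVec SX H fb t f).re
        + (star x ⬝ᵥ sampledPSD SX Sη H fb f *ᵥ x).re :=
  (hf.hasSum_risk hSX0 hSη0 t x).nonneg fun k =>
    add_nonneg (mul_nonneg (hSX0 _) (by positivity)) (mul_nonneg (hSη0 _) (by positivity))

end Aliasing

end SubNyquist

namespace SubNyquist

/-! ### The minimal risk at a fixed time. -/

section OptimalRisk

open scoped ComplexOrder

variable {P : ℕ} {SX Sη : ℝ → ℝ} {H : Fin P → ℝ → ℂ} {fb : ℝ}

/-- The value of the optimal symbol. -/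
noncomputable def optSymbol (SX Sη : ℝ → ℝ) (H : Fin P → ℝ → ℂ) (fb t f : ℝ) : Fin P → ℂ :=
  pinv (sampledPSD SX Sη H fb f) *ᵥ crossVec SX H fb t f

lemma measurable_sampledPSD (hSX : Measurable SX) (hSη : Measurable Sη)
    (hH : ∀ p, Measurable (H p)) (i j : Fin P) :
    Measurable fun f => sampledPSD SX Sη H fb f i j := by
  simp only [sampledPSD, Matrix.of_apply]
  have := hH i
  have := hH j
  have := Complex.continuous_conj.measurable
  refine Measurable.tsum fun k => ?_
  fun_prop

lemma measurable_crossVec (hSX : Measurable SX) (hH : ∀ p, Measurable (H p)) (p : Fin P) :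
    Measurable fun q : ℝ × ℝ => crossVec SX H fb q.1 q.2 p := by
  simp only [crossVec, expSymbol]
  have := hH p
  have := Complex.continuous_conj.measurable
  refine Measurable.tsum fun k => ?_
  fun_prop

lemma measurable_aliasSum (hSX : Measurable SX) : Measurable (aliasSum SX fb) :=
  Measurable.tsum fun k => by fun_prop

lemma IsRegularFreq.gain_nonneg_le {f : ℝ} (hf : IsRegularFreq SX Sη H fb f)
    (hSX0 : ∀ f, 0 ≤ SX f) (hSη0 : ∀ f, 0 ≤ Sη f) (t : ℝ) :
    0 ≤ gain SX Sη H fb t f ∧ gain SX Sη H fb t f ≤ aliasSum SX fb f :=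
  (pinv_quadratic_nonneg (hf.posSemidef hSX0 hSη0) (hf.quadratic_nonneg hSX0 hSη0 t)).2

lemma IsRegularFreq.quadratic_eq {f : ℝ} (hf : IsRegularFreq SX Sη H fb f)
    (hSX0 : ∀ f, 0 ≤ SX f) (hSη0 : ∀ f, 0 ≤ Sη f) (t : ℝ) (x : Fin P → ℂ) :
    aliasSum SX fb f - 2 * (star x ⬝ᵥ crossVec SX H fb t f).re
        + (star x ⬝ᵥ sampledPSD SX Sη H fb f *ᵥ x).re
      = aliasSum SX fb f - gain SX Sη H fb t f
        + (star (x - optSymbol SX Sη H fb t f) ⬝ᵥ sampledPSD SX Sη H fb f *ᵥ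
          (x - optSymbol SX Sη H fb t f)).re :=
  SubNyquist.quadratic_eq (hf.posSemidef hSX0 hSη0) (hf.quadratic_nonneg hSX0 hSη0 t) x

/-- The standing assumptions on the spectral densities and the frequency responses. -/
structure Admissible (SX Sη : ℝ → ℝ) (H : Fin P → ℝ → ℂ) : Prop where
  source_int : Integrable SX
  source_meas : Measurable SX
  source_nonneg : ∀ f, 0 ≤ SX f
  noise_meas : Measurable Sη
  noise_nonneg : ∀ f, 0 ≤ Sη f
  response_meas : ∀ p, Measurable (H p)
  response_fin : ∀ p, Integrable fun f => (SX f + Sη f) * ‖H p f‖ ^ 2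

namespace Admissible

lemma ae_regular (h : Admissible SX Sη H) (hfb : 0 < fb) :
    ∀ᵐ f ∂(volume.restrict (band fb)), IsRegularFreq SX Sη H fb f :=
  ae_isRegularFreq hfb h.source_int h.source_meas h.source_nonneg h.noise_meas h.noise_nonneg
    h.response_meas h.response_fin

lemma aemeasurable_pinv (h : Admissible SX Sη H) (hfb : 0 < fb) (i j : Fin P) :
    AEMeasurable (fun f => pinv (sampledPSD SX Sη H fb f) i j) (volume.restrict (band fb)) :=
  SubNyquist.aemeasurable_pinv
    (measurable_sampledPSD h.source_meas h.noise_meas h.response_meas)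
    ((h.ae_regular hfb).mono fun _ hf => hf.posSemidef h.source_nonneg h.noise_nonneg) i j

lemma aemeasurable_optSymbol (h : Admissible SX Sη H) (hfb : 0 < fb) (t : ℝ) :
    AEMeasurable (optSymbol SX Sη H fb t) (volume.restrict (band fb)) := by
  rw [aemeasurable_pi_iff]
  intro p
  simp only [optSymbol, Matrix.mulVec, dotProduct]
  refine Finset.aemeasurable_fun_sum _ fun j _ => (h.aemeasurable_pinv hfb p j).mul ?_
  exact ((measurable_crossVec h.source_meas h.response_meas j).comp
    (measurable_const.prodMk measurable_id)).aemeasurable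

/-- Joint measurability in time and frequency, for exchanging the two integrals. The pseudo-inverse
depends on frequency only, and its almost-everywhere measurability pulls back along the second
projection. -/
lemma aemeasurable_uncurry_gain (h : Admissible SX Sη H)
    (hfb : 0 < fb) (ν : Measure ℝ) [SFinite ν] :
    AEMeasurable (fun q : ℝ × ℝ => gain SX Sη H fb q.1 q.2)
      (ν.prod (volume.restrict (band fb))) := by
  simp only [gain, Matrix.mulVec, dotProduct]
  refine Complex.measurable_re.comp_aemeasurable ?_
  refine Finset.aemeasurable_fun_sum _ fun i _ => AEMeasurable.mul ?_ ?_
  · exact (Complex.continuous_conj.measurable.comp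
      (measurable_crossVec h.source_meas h.response_meas i)).aemeasurable
  · refine Finset.aemeasurable_fun_sum _ fun j _ => AEMeasurable.mul ?_ ?_
    · exact (h.aemeasurable_pinv hfb i j).comp_quasiMeasurePreserving
        Measure.quasiMeasurePreserving_snd
    · exact (measurable_crossVec h.source_meas h.response_meas j).aemeasurable

lemma aemeasurable_gain (h : Admissible SX Sη H) (hfb : 0 < fb) (t : ℝ) :
    AEMeasurable (gain SX Sη H fb t) (volume.restrict (band fb)) := by
  have hw := h.aemeasurable_optSymbol hfb t
  rw [aemeasurable_pi_iff] at hw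
  refine Complex.measurable_re.comp_aemeasurable ?_
  refine Finset.aemeasurable_fun_sum _ fun i _ => AEMeasurable.mul ?_ (hw i)
  exact (Complex.continuous_conj.measurable.comp
      ((measurable_crossVec h.source_meas h.response_meas i).comp
    (measurable_const.prodMk measurable_id))).aemeasurable

/-- The spectral risk of an estimator with periodic symbol, as an integral over one band. -/
lemma risk_eq (h : Admissible SX Sη H)
    [Fact (0 < fb)] {φ : Fin P → AddCircle fb → ℂ} (hφ : ∀ p, Measurable (φ p))
    (t : ℝ) :
    risk SX Sη t (fun f => ∑ p, φ p f * H p f)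
      = ∫⁻ f in band fb, ENNReal.ofReal (aliasSum SX fb f - gain SX Sη H fb t f
        + (star ((fun p => φ p f) - optSymbol SX Sη H fb t f) ⬝ᵥ sampledPSD SX Sη H fb f *ᵥ
          ((fun p => φ p f) - optSymbol SX Sη H fb t f)).re) := by
  have hfb : 0 < fb := Fact.out
  have hmk : Measurable fun f : ℝ => (f : AddCircle fb) := AddCircle.measurable_mk'
  have hφm : ∀ p, Measurable fun f : ℝ => φ p f := fun p => (hφ p).comp hmk
  have hHm := h.response_meas
  have hXm := h.source_meas
  have hηm := h.noise_meas
  have hem := (continuous_expSymbol t).measurable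
  have h1 : ∀ f : ℝ, ENNReal.ofReal (SX f) * ‖expSymbol t f - ∑ p, φ p f * H p f‖ₑ ^ 2
      + ENNReal.ofReal (Sη f) * ‖∑ p, φ p f * H p f‖ₑ ^ 2
      = ENNReal.ofReal (SX f * ‖expSymbol t f - ∑ p, φ p f * H p f‖ ^ 2
        + Sη f * ‖∑ p, φ p f * H p f‖ ^ 2) := fun f => by
    rw [ENNReal.ofReal_add (mul_nonneg (h.source_nonneg f) (by positivity))
      (mul_nonneg (h.noise_nonneg f) (by positivity)), ENNReal.ofReal_mul (h.source_nonneg f),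
      ENNReal.ofReal_mul (h.noise_nonneg f), ENNReal.ofReal_pow (norm_nonneg _),
      ENNReal.ofReal_pow (norm_nonneg _), ofReal_norm, ofReal_norm]
  simp only [risk, h1]
  rw [lintegral_eq_lintegral_band hfb (by fun_prop)]
  refine lintegral_congr_ae ?_
  filter_upwards [h.ae_regular hfb] with f hf
  have hper : ∀ k : ℤ, ((f - fb * k : ℝ) : AddCircle fb) = f := fun k => by
    rw [AddCircle.coe_sub, (AddCircle.coe_eq_zero_iff fb (x := fb * k)).2
      ⟨k, by rw [zsmul_eq_mul, mul_comm]⟩,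
      sub_zero]
  simp only [hper]
  have hs := hf.hasSum_risk h.source_nonneg h.noise_nonneg t (fun p => φ p f)
  rw [← hf.quadratic_eq h.source_nonneg h.noise_nonneg, ← hs.tsum_eq,
    ENNReal.ofReal_tsum_of_nonneg _ hs.summable]
  exact fun k => add_nonneg (mul_nonneg (h.source_nonneg _) (by positivity))
    (mul_nonneg (h.noise_nonneg _) (by positivity))

lemma le_risk (h : Admissible SX Sη H)
    [Fact (0 < fb)] {φ : Fin P → AddCircle fb → ℂ} (hφ : ∀ p, Measurable (φ p))
    (t : ℝ) :
    ∫⁻ f in band fb, ENNReal.ofReal (aliasSum SX fb f - gain SX Sη H fb t f)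
      ≤ risk SX Sη t (fun f => ∑ p, φ p f * H p f) := by
  rw [h.risk_eq hφ]
  refine lintegral_mono_ae ?_
  filter_upwards [h.ae_regular Fact.out] with f hf
  refine ENNReal.ofReal_le_ofReal (le_add_of_nonneg_right ?_)
  exact (Complex.nonneg_iff.1 ((hf.posSemidef h.source_nonneg
    h.noise_nonneg).dotProduct_mulVec_nonneg _)).1

/-- Truncations of the optimal symbol attain the optimal risk in the limit. -/
lemma exists_tendsto_risk (h : Admissible SX Sη H) [Fact (0 < fb)] (t : ℝ) :
    ∃ φ : ℕ → Fin P → AddCircle fb → ℂ, (∀ n p, Measurable (φ n p)) ∧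
      (∀ n p θ, ‖φ n p θ‖ ≤ n) ∧
      Tendsto (fun n => risk SX Sη t (fun f => ∑ p, φ n p f * H p f)) atTop
        (𝓝 (∫⁻ f in band fb, ENNReal.ofReal (aliasSum SX fb f - gain SX Sη H fb t f))) := by
  have hfb : 0 < fb := Fact.out
  have hw := h.aemeasurable_optSymbol hfb t
  set w := hw.mk with hw_def
  have hwm : Measurable w := hw.measurable_mk
  -- The representative in the band turns a function on the band into a periodic symbol.
  set rep : AddCircle fb → ℝ := fun θ => (AddCircle.measurableEquivIoc fb (-(fb / 2)) θ : ℝ)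
  have hrep : Measurable rep :=
    measurable_subtype_coe.comp (AddCircle.measurableEquivIoc fb (-(fb / 2))).measurable
  have hrep' : ∀ f ∈ band fb, rep (f : AddCircle fb) = f := fun f hf => by
    have hf' : f ∈ Set.Ioc (-(fb / 2)) (-(fb / 2) + fb) := ⟨hf.1, by linarith [hf.2]⟩
    change ((AddCircle.equivIoc fb (-(fb / 2)) (f : AddCircle fb) : _) : ℝ) = f
    rw [AddCircle.equivIoc_coe_eq hf']
  refine ⟨fun n p θ => if ‖w (rep θ)‖ ≤ n then w (rep θ) p else 0, fun n p => ?_,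
    fun n p θ => ?_, ?_⟩
  · refine Measurable.ite (measurableSet_le (hwm.comp hrep).norm measurable_const) ?_
      measurable_const
    exact (measurable_pi_apply p).comp (hwm.comp hrep)
  · dsimp only
    split_ifs with hn
    · exact (norm_le_pi_norm _ p).trans hn
    · simp
  have hφ : ∀ n : ℕ, ∀ p, Measurable fun θ : AddCircle fb =>
      if ‖w (rep θ)‖ ≤ n then w (rep θ) p else 0 := fun n p =>
    Measurable.ite (measurableSet_le (hwm.comp hrep).norm measurable_const)
      ((measurable_pi_apply p).comp (hwm.comp hrep)) measurable_const
  -- Where the symbol is cut to zero, the excess is `w*Aw`, which equals the gain at the optimum;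
  -- the integrand there is the full aliased density.
  have hEq : ∀ n : ℕ, risk SX Sη t (fun f => ∑ p,
      (if ‖w (rep f)‖ ≤ n then w (rep f) p else 0) * H p f)
      = ∫⁻ f in band fb, ENNReal.ofReal (aliasSum SX fb f - gain SX Sη H fb t f
        + if ‖w f‖ ≤ n then 0 else gain SX Sη H fb t f) := fun n => by
    rw [h.risk_eq (hφ n)]
    refine lintegral_congr_ae ?_
    filter_upwards [h.ae_regular hfb, hw.ae_eq_mk, ae_restrict_mem measurableSet_Ioc]
      with f hf hwf hfm
    rw [hrep' f hfm, hwf, ← hw_def]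
    congr 2
    split_ifs with hn
    · have : (fun p => w f p) - w f = 0 := sub_self _
      rw [this]; simp
    · have : (fun _ : Fin P => (0 : ℂ)) - w f = - w f := zero_sub _
      rw [this, Matrix.mulVec_neg, star_neg, neg_dotProduct_neg, hw_def, ← hwf]
      exact (pinv_quadratic_nonneg (hf.posSemidef h.source_nonneg h.noise_nonneg)
        (hf.quadratic_nonneg h.source_nonneg h.noise_nonneg t)).1
  simp only [hEq]
  -- The aliased source density dominates every integrand, and each frequency is eventually
  -- untruncated.
  refine tendsto_lintegral_of_dominated_convergence'
    (fun f => ENNReal.ofReal (aliasSum SX fb f)) (fun n => ?_) (fun n => ?_) ?_ ?_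
  · have hg := h.aemeasurable_gain hfb t
    have hs := (measurable_aliasSum (fb := fb) h.source_meas)
    refine AEMeasurable.ennreal_ofReal ((hs.aemeasurable.sub hg).add ?_)
    have hset : MeasurableSet {f | ‖w f‖ ≤ n} := measurableSet_le hwm.norm measurable_const
    have := hg.indicator hset.compl
    refine this.congr (Eventually.of_forall fun f => ?_)
    simp only [Set.indicator, Set.mem_compl_iff, Set.mem_ofPred_eq]
    split_ifs <;> simp_all
  · filter_upwards [h.ae_regular hfb] with f hf
    have := hf.gain_nonneg_le h.source_nonneg h.noise_nonneg t
    refine ENNReal.ofReal_le_ofReal ?_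
    split_ifs <;> linarith
  · exact (integrable_tsum_band hfb h.source_meas h.source_nonneg
      h.source_int).1.lintegral_lt_top.ne
  · refine Eventually.of_forall fun f => ?_
    refine tendsto_const_nhds.congr' ?_
    filter_upwards [eventually_ge_atTop ⌈‖w f‖⌉₊] with n hn
    rw [if_pos ((Nat.le_ceil _).trans (by exact_mod_cast hn)), add_zero]

end Admissible

end OptimalRisk

end SubNyquist

namespace SubNyquist

/-! ### Periodicity in time and the average gain. -/

section TimeAverage

lemma tendsto_mean_of_periodic {g : ℝ → ℝ} {T : ℝ} (hg : Function.Periodic g T) (hT : 0 < T)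
    (hint : IntervalIntegrable g volume 0 T) :
    Tendsto (fun R : ℝ => (2 * R)⁻¹ * ∫ t in (-R)..R, g t) atTop
      (𝓝 (T⁻¹ * ∫ t in (0)..T, g t)) := by
  set I := ∫ t in (0)..T, g t with hI
  have hii : ∀ a b, IntervalIntegrable g volume a b := hg.intervalIntegrable₀ hT.ne' hint
  -- The primitive stays at bounded distance from a linear function: its extremes over one period
  -- account for the partial period, and `|I|` for replacing the floor of `R / T` by `R / T`. Since
  -- `R` may be negative, the bound serves both halves of `[-R, R]`.
  obtain ⟨C, hC⟩ : ∃ C, ∀ R, |(∫ t in (0)..R, g t) - R / T * I| ≤ C := by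
    refine ⟨|sInf ((fun t => ∫ x in (0)..t, g x) '' Set.Icc 0 T)| +
      |sSup ((fun t => ∫ x in (0)..t, g x) '' Set.Icc 0 T)| + |I|, fun R => ?_⟩
    have h1 := hg.sInf_add_zsmul_le_integral_of_pos hint hT R
    have h2 := hg.integral_le_sSup_add_zsmul_of_pos hint hT R
    rw [← hI, zsmul_eq_mul] at h1 h2
    have h3 : |(R / T - ⌊R / T⌋) * I| ≤ |I| := by
      rw [abs_mul, Int.self_sub_floor, abs_of_nonneg (Int.fract_nonneg _)]
      exact mul_le_of_le_one_left (abs_nonneg _) (Int.fract_lt_one _).le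
    rw [sub_mul] at h3
    have h4 := abs_le.1 h3
    have h5 := neg_abs_le (sInf ((fun t => ∫ x in (0)..t, g x) '' Set.Icc 0 T))
    have h6 := le_abs_self (sSup ((fun t => ∫ x in (0)..t, g x) '' Set.Icc 0 T))
    have h7 := abs_nonneg (sInf ((fun t => ∫ x in (0)..t, g x) '' Set.Icc 0 T))
    have h8 := abs_nonneg (sSup ((fun t => ∫ x in (0)..t, g x) '' Set.Icc 0 T))
    rw [abs_le]
    constructor <;> linarith [h4.1, h4.2]
  rw [tendsto_iff_norm_sub_tendsto_zero]
  have hlim : Tendsto (fun R : ℝ => C * R⁻¹) atTop (𝓝 0) := by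
    simpa using tendsto_inv_atTop_zero.const_mul C
  refine squeeze_zero' (Eventually.of_forall fun _ => norm_nonneg _) ?_ hlim
  filter_upwards [eventually_gt_atTop 0] with R hR
  have h1 : ∫ t in (-R)..R, g t = (∫ t in (0)..R, g t) - ∫ t in (0)..(-R), g t := by
    rw [intervalIntegral.integral_interval_sub_left (hii _ _) (hii _ _)]
  have h2 : (2 * R)⁻¹ * (∫ t in (-R)..R, g t) - T⁻¹ * I
      = (2 * R)⁻¹ * (((∫ t in (0)..R, g t) - R / T * I)
        - ((∫ t in (0)..(-R), g t) - (-R) / T * I)) := by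
    rw [h1]; field_simp; ring
  rw [h2, norm_mul, Real.norm_of_nonneg (by positivity), Real.norm_eq_abs]
  have h3 := (abs_sub _ _).trans (add_le_add (hC R) (hC (-R)))
  calc (2 * R)⁻¹ * _ ≤ (2 * R)⁻¹ * (C + C) := by gcongr
    _ = C * R⁻¹ := by field_simp; ring

lemma expSymbol_add (t u f : ℝ) : expSymbol (t + u) f = expSymbol t f * expSymbol u f := by
  rw [expSymbol, expSymbol, expSymbol, ← Complex.exp_add]
  congr 1; push_cast; ring

lemma measurable_expSymbol_left (f : ℝ) : Measurable fun t => expSymbol t f := by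
  unfold expSymbol; fun_prop

lemma expSymbol_sub_mul_int {T fb : ℝ} (h : T * fb = 1) (f : ℝ) (k : ℤ) :
    expSymbol T (f - fb * k) = expSymbol T f := by
  rw [expSymbol, expSymbol, Complex.exp_eq_exp_iff_exists_int]
  refine ⟨-k, ?_⟩
  have h' : (T : ℂ) * fb = 1 := by exact_mod_cast h
  push_cast
  linear_combination (-2 * Real.pi * Complex.I * k) * h'

/-- Orthogonality of the exponentials over one sampling period. -/
lemma integral_expSymbol_orthogonal {T fb : ℝ} (h : T * fb = 1) (f : ℝ) (k l : ℤ) :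
    ∫ t in (0)..T, conj (expSymbol t (f - fb * k)) * expSymbol t (f - fb * l)
      = if k = l then (T : ℂ) else 0 := by
  have hT : (T : ℂ) ≠ 0 := fun h0 => by
    have : T = 0 := by exact_mod_cast h0
    simp [this] at h
  have h' : (T : ℂ) * fb = 1 := by exact_mod_cast h
  have hfb : (fb : ℂ) ≠ 0 := right_ne_zero_of_mul_eq_one h'
  have h1 : ∀ t : ℝ, conj (expSymbol t (f - fb * k)) * expSymbol t (f - fb * l)
      = Complex.exp ((2 * Real.pi * Complex.I * fb * (k - l)) * t) := fun t => by
    rw [expSymbol, expSymbol, ← Complex.exp_conj, ← Complex.exp_add]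
    congr 1
    simp only [map_mul, Complex.conj_ofReal, Complex.conj_I, map_ofNat]
    push_cast; ring
  simp only [h1]
  split_ifs with hkl
  · subst hkl
    simp
  · have hne : (2 * Real.pi * Complex.I * fb * (k - l) : ℂ) ≠ 0 := by
      have : ((k : ℂ) - l) ≠ 0 := sub_ne_zero.2 (by exact_mod_cast hkl)
      have hpi : (Real.pi : ℂ) ≠ 0 := by exact_mod_cast Real.pi_ne_zero
      simp [this, hfb, hpi]
    rw [integral_exp_mul_complex hne]
    have h2 : (2 * Real.pi * Complex.I * fb * (k - l) : ℂ) * T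
        = (k - l : ℤ) * (2 * Real.pi * Complex.I) := by
      push_cast
      linear_combination (2 * Real.pi * Complex.I * (k - l)) * h'
    rw [h2, Complex.exp_int_mul_two_pi_mul_I]
    simp

lemma norm_tsum_mul_expSymbol_le {a : ℤ → ℂ} (ha : Summable fun k => ‖a k‖) (x : ℤ → ℝ) (t : ℝ) :
    ‖∑' k, a k * expSymbol t (x k)‖ ≤ ∑' k, ‖a k‖ := by
  refine tsum_of_norm_bounded ha.hasSum fun k => ?_
  rw [norm_mul, norm_expSymbol, mul_one]

lemma measurable_tsum_mul_expSymbol (a : ℤ → ℂ) (x : ℤ → ℝ) :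
    Measurable fun t => ∑' k, a k * expSymbol t (x k) :=
  Measurable.tsum fun k => (measurable_expSymbol_left (x k)).const_mul _

lemma integral_mul_tsum {u : ℝ → ℂ} (hu : Measurable u) {C : ℝ} (hC : ∀ t, ‖u t‖ ≤ C)
    {a : ℤ → ℂ} (ha : Summable fun k => ‖a k‖) (x : ℤ → ℝ) (T : ℝ) :
    ∫ t in (0)..T, u t * ∑' k, a k * expSymbol t (x k)
      = ∑' k, a k * ∫ t in (0)..T, u t * expSymbol t (x k) := by
  have h := intervalIntegral.hasSum_integral_of_dominated_convergence (μ := volume) (a := 0)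
    (b := T) (F := fun k t => u t * (a k * expSymbol t (x k)))
    (f := fun t => u t * ∑' k, a k * expSymbol t (x k))
    (fun k _ => C * ‖a k‖) (fun k => ?_) (fun k => ?_) ?_ ?_ ?_
  · rw [← h.tsum_eq]
    refine tsum_congr fun k => ?_
    rw [← intervalIntegral.integral_const_mul]
    congr 1; ext t; ring
  · exact (hu.mul ((measurable_expSymbol_left (x k)).const_mul _)).aestronglyMeasurable
  · refine Eventually.of_forall fun t _ => ?_
    rw [norm_mul, norm_mul, norm_expSymbol, mul_one]
    gcongr
    exact hC t
  · exact Eventually.of_forall fun t _ => ha.mul_left C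
  · exact intervalIntegrable_const
  · refine Eventually.of_forall fun t _ => ?_
    refine HasSum.mul_left _ (Summable.hasSum ?_)
    refine Summable.of_norm (ha.congr fun k => ?_)
    rw [norm_mul, norm_expSymbol, mul_one]

/-- Parseval's identity for absolutely convergent exponential series. -/
lemma integral_conj_tsum_mul_tsum {a b : ℤ → ℂ} (ha : Summable fun k => ‖a k‖)
    (hb : Summable fun k => ‖b k‖) {T fb : ℝ} (h : T * fb = 1) (f : ℝ) :
    ∫ t in (0)..T, conj (∑' k, a k * expSymbol t (f - fb * k))
        * ∑' k : ℤ, b k * expSymbol t (f - fb * k)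
      = T * ∑' k, conj (a k) * b k := by
  have hconj := Complex.continuous_conj.measurable
  have ma := measurable_tsum_mul_expSymbol a (fun k => f - fb * k)
  rw [integral_mul_tsum (u := fun t => conj (∑' k, a k * expSymbol t (f - fb * k)))
    (x := fun k => f - fb * k) (hconj.comp ma) (C := ∑' k, ‖a k‖) (fun t => by
      rw [Complex.norm_conj]
      exact norm_tsum_mul_expSymbol_le ha _ t) hb, ← tsum_mul_left]
  refine tsum_congr fun l => ?_
  have h1 : ∫ t in (0)..T, conj (∑' k, a k * expSymbol t (f - fb * k)) * expSymbol t (f - fb * l)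
      = conj (∫ t in (0)..T, conj (expSymbol t (f - fb * l))
        * ∑' k, a k * expSymbol t (f - fb * k)) := by
    have hc : ∀ g : ℝ → ℂ, conj (∫ t in (0)..T, g t) = ∫ t in (0)..T, conj (g t) := fun g => by
      simp only [intervalIntegral, integral_conj, map_sub]
    rw [hc]
    congr 1; ext t
    rw [map_mul, Complex.conj_conj, mul_comm]
  have h2 : ∫ t in (0)..T, conj (expSymbol t (f - fb * l))
        * ∑' k, a k * expSymbol t (f - fb * k) = a l * T := by
    rw [integral_mul_tsum (u := fun t => conj (expSymbol t (f - fb * l)))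
      (x := fun k => f - fb * k) (hconj.comp (measurable_expSymbol_left _)) (C := 1) (fun t => by
        rw [Complex.norm_conj, norm_expSymbol]) ha]
    simp only [integral_expSymbol_orthogonal h]
    rw [tsum_eq_single l fun k hk => by rw [if_neg hk.symm, mul_zero], if_pos rfl]
  rw [h1, h2, map_mul, Complex.conj_ofReal]
  ring

variable {P : ℕ} {SX Sη : ℝ → ℝ} {H : Fin P → ℝ → ℂ} {fb T : ℝ}

/-- All aliases of `f` acquire the same phase under a shift by one sampling period. The phase
cancels in the gain. -/
lemma crossVec_add_period (h : T * fb = 1) (t f : ℝ) :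
    crossVec SX H fb (t + T) f = expSymbol T f • crossVec SX H fb t f := by
  ext p
  rw [Pi.smul_apply, crossVec, crossVec, smul_eq_mul, ← tsum_mul_left]
  refine tsum_congr fun k => ?_
  rw [expSymbol_add, expSymbol_sub_mul_int h]
  ring

lemma gain_periodic (h : T * fb = 1) (f : ℝ) :
    Function.Periodic (fun t => gain SX Sη H fb t f) T := fun t => by
  simp only [gain]
  rw [crossVec_add_period h, Matrix.mulVec_smul, star_smul, smul_dotProduct, dotProduct_smul,
    smul_smul, Complex.star_def, Complex.conj_mul', norm_expSymbol]
  simp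

/-- Cyclicity of the trace merges the two inverse square roots into the pseudo-inverse. -/
lemma estimatorTrace_eq (f : ℝ) :
    estimatorTrace SX Sη H fb f
      = (∑ i, ∑ j, pinv (sampledPSD SX Sη H fb f) i j * crossPSD SX H fb f j i).re := by
  rw [estimatorTrace, estimatorPSD, (isHermitian_invSqrt _).eq,
    Matrix.trace_mul_comm, ← Matrix.mul_assoc]
  rfl

/-- The time average of the gain over one sampling period is the trace of the estimator
density. -/
lemma IsRegularFreq.integral_gain {f : ℝ} (hf : IsRegularFreq SX Sη H fb f)
    (hSX0 : ∀ f, 0 ≤ SX f) (hSη0 : ∀ f, 0 ≤ Sη f) (h : T * fb = 1) :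
    ∫ t in (0)..T, gain SX Sη H fb t f = T * estimatorTrace SX Sη H fb f := by
  set a : Fin P → ℤ → ℂ := fun p k => (SX (f - fb * k) : ℂ) * conj (H p (f - fb * k)) with ha_def
  have ha : ∀ p, Summable fun k => ‖a p k‖ := fun p =>
    ((hf.summable_crossVec hSX0 hSη0 0 p).norm).congr fun k => by
      rw [norm_mul, norm_expSymbol, mul_one]
  have hv : ∀ t p, crossVec SX H fb t f p = ∑' k, a p k * expSymbol t (f - fb * k) :=
    fun t p => rfl
  set M := pinv (sampledPSD SX Sη H fb f) with hM
  have hint : ∀ i j, IntervalIntegrable (fun t => conj (crossVec SX H fb t f i)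
      * crossVec SX H fb t f j) volume 0 T := fun i j => by
    simp only [hv]
    have hm : Measurable fun t => conj (∑' k, a i k * expSymbol t (f - fb * k))
        * ∑' k, a j k * expSymbol t (f - fb * k) :=
      (Complex.continuous_conj.measurable.comp
        (measurable_tsum_mul_expSymbol (a i) (fun k => f - fb * k))).mul
        (measurable_tsum_mul_expSymbol (a j) (fun k => f - fb * k))
    refine (intervalIntegrable_const (c := (∑' k, ‖a i k‖) * ∑' k, ‖a j k‖)).mono_fun
      hm.aestronglyMeasurable (Eventually.of_forall fun t => ?_)
    dsimp only
    rw [norm_mul, Complex.norm_conj]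
    refine le_trans ?_ (le_abs_self _)
    exact mul_le_mul (norm_tsum_mul_expSymbol_le (ha i) _ t)
      (norm_tsum_mul_expSymbol_le (ha j) _ t) (norm_nonneg _)
      (tsum_nonneg fun k => norm_nonneg _)
  have h1 : ∀ t, gain SX Sη H fb t f = (∑ i, ∑ j, M i j * (conj (crossVec SX H fb t f i)
      * crossVec SX H fb t f j)).re := fun t => by
    simp only [gain, dotProduct, Matrix.mulVec, Finset.mul_sum]
    congr 1
    refine Finset.sum_congr rfl fun i _ => Finset.sum_congr rfl fun j _ => ?_
    rw [Pi.star_apply, Complex.star_def]; ring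
  have h2 : ∀ i j, ∫ t in (0)..T, conj (crossVec SX H fb t f i) * crossVec SX H fb t f j
      = T * crossPSD SX H fb f j i := fun i j => by
    simp only [hv]
    rw [integral_conj_tsum_mul_tsum (ha i) (ha j) h f, crossPSD, Matrix.of_apply]
    congr 1
    refine tsum_congr fun k => ?_
    simp only [ha_def, map_mul, Complex.conj_ofReal, Complex.conj_conj]
    push_cast; ring
  have hint' : ∀ i j, IntervalIntegrable (fun t => M i j * (conj (crossVec SX H fb t f i)
      * crossVec SX H fb t f j)) volume 0 T := fun i j => (hint i j).const_mul _
  have hint2 : ∀ i, IntervalIntegrable (fun t => ∑ j, M i j * (conj (crossVec SX H fb t f i)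
      * crossVec SX H fb t f j)) volume 0 T := fun i =>
    ⟨integrable_finsetSum _ fun j _ => (hint' i j).1,
      integrable_finsetSum _ fun j _ => (hint' i j).2⟩
  have hint3 : IntervalIntegrable (fun t => ∑ i, ∑ j, M i j * (conj (crossVec SX H fb t f i)
      * crossVec SX H fb t f j)) volume 0 T :=
    ⟨integrable_finsetSum _ fun i _ => (hint2 i).1, integrable_finsetSum _ fun i _ => (hint2 i).2⟩
  have h3 := Complex.reCLM.intervalIntegral_comp_comm hint3
  simp only [Complex.reCLM_apply] at h3
  simp only [h1]
  rw [h3, intervalIntegral.integral_finsetSum fun i _ => hint2 i, estimatorTrace_eq,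
    ← Complex.re_ofReal_mul, Finset.mul_sum]
  congr 1
  refine Finset.sum_congr rfl fun i _ => ?_
  rw [intervalIntegral.integral_finsetSum fun j _ => hint' i j, Finset.mul_sum]
  refine Finset.sum_congr rfl fun j _ => ?_
  rw [intervalIntegral.integral_const_mul, h2, ← hM]
  ring

namespace Admissible

lemma integrable_aliasSum (h : Admissible SX Sη H) (hfb : 0 < fb) :
    Integrable (aliasSum SX fb) (volume.restrict (band fb)) ∧
      ∫ f in band fb, aliasSum SX fb f = ∫ f, SX f :=
  integrable_tsum_band hfb h.source_meas h.source_nonneg h.source_int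

lemma integrable_gain (h : Admissible SX Sη H) (hfb : 0 < fb) (t : ℝ) :
    Integrable (gain SX Sη H fb t) (volume.restrict (band fb)) := by
  refine (h.integrable_aliasSum hfb).1.mono' (h.aemeasurable_gain hfb t).aestronglyMeasurable ?_
  filter_upwards [h.ae_regular hfb] with f hf
  have := hf.gain_nonneg_le h.source_nonneg h.noise_nonneg t
  rw [Real.norm_of_nonneg this.1]
  exact this.2

lemma integrable_uncurry_gain (h : Admissible SX Sη H)
    (hfb : 0 < fb) (ν : Measure ℝ) [IsFiniteMeasure ν] :
    Integrable (fun q : ℝ × ℝ => gain SX Sη H fb q.1 q.2)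
      (ν.prod (volume.restrict (band fb))) := by
  refine ((h.integrable_aliasSum hfb).1.comp_snd ν).mono'
    (h.aemeasurable_uncurry_gain hfb ν).aestronglyMeasurable ?_
  filter_upwards [Measure.quasiMeasurePreserving_snd.ae (h.ae_regular hfb)] with q hq
  have := hq.gain_nonneg_le h.source_nonneg h.noise_nonneg q.1
  rw [Real.norm_of_nonneg this.1]
  exact this.2

/-- The average over a sampling period of the integrated gain. -/
lemma integral_integral_gain (h : Admissible SX Sη H)
    (hfb : 0 < fb) (hT : T * fb = 1) (hT0 : 0 < T) :
    IntervalIntegrable (fun t => ∫ f in band fb, gain SX Sη H fb t f) volume 0 T ∧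
    ∫ t in (0)..T, ∫ f in band fb, gain SX Sη H fb t f
      = T * ∫ f in band fb, estimatorTrace SX Sη H fb f := by
  have hi := h.integrable_uncurry_gain hfb (volume.restrict (Set.Ioc 0 T))
  refine ⟨(intervalIntegrable_iff_integrableOn_Ioc_of_le hT0.le).2 hi.integral_prod_left, ?_⟩
  rw [intervalIntegral.integral_of_le hT0.le, integral_integral_swap hi, ← integral_const_mul]
  refine integral_congr_ae ?_
  filter_upwards [h.ae_regular hfb] with f hf
  rw [← hf.integral_gain h.source_nonneg h.noise_nonneg hT,
    intervalIntegral.integral_of_le hT0.le]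

lemma integrable_estimatorTrace (h : Admissible SX Sη H) (hfb : 0 < fb) :
    Integrable (estimatorTrace SX Sη H fb) (volume.restrict (band fb)) := by
  set T := fb⁻¹
  have hT : T * fb = 1 := inv_mul_cancel₀ hfb.ne'
  have hT0 : 0 < T := inv_pos.2 hfb
  have hi := (h.integrable_uncurry_gain hfb (volume.restrict (Set.Ioc 0 T))).integral_prod_right
  refine (hi.const_mul fb).congr ?_
  filter_upwards [h.ae_regular hfb] with f hf
  have := hf.integral_gain h.source_nonneg h.noise_nonneg hT
  rw [intervalIntegral.integral_of_le hT0.le] at this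
  rw [this, ← mul_assoc, mul_comm fb, hT, one_mul]

end Admissible

end TimeAverage

end SubNyquist

namespace SubNyquist

/-! ### The mean-square error in time. -/

section MeanSquareError

variable {Ω : Type*} {m : MeasurableSpace Ω} [MeasurableSpace Ω] {μ : Measure Ω} {P : ℕ}
  {SX Sη : ℝ → ℝ}
  {X : ℝ → Ω → ℝ} {η : TestFunction Sη → Ω → ℝ} {H : Fin P → ℝ → ℂ} {Z : Fin P → ℝ → Ω → ℝ}
  {Y : Fin P → ℤ → Ω → ℝ} {fb : ℝ}

lemma IsStationaryGaussianProcess.integral_sq (hX : IsStationaryGaussianProcess μ SX X) (t : ℝ) :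
    ∫ ω, X t ω ^ 2 ∂μ = ∫ f, SX f := by
  have h := hX.covariance t t
  simp only [Complex.mul_conj', norm_expSymbol, Complex.ofReal_one, one_pow, one_mul,
    integral_complex_ofReal, Complex.ofReal_inj] at h
  simpa only [sq] using h

lemma Admissible.integral_sq_sub_condExp [IsProbabilityMeasure μ] [Fact (0 < fb)]
    (h : Admissible SX Sη H)
    (hX : IsStationaryGaussianProcess μ SX X) (hη : IsStationaryGaussianNoise μ Sη η)
    (hXη : IndepFun (fun ω t => X t ω) (fun ω φ => η φ ω) μ)
    (hZ : ∀ p, IsNoisyFilterOutput μ SX Sη X η (H p) (Z p))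
    {τ : ℤ → ℝ} (hτ : ∀ n, τ n * fb = n) (hY : ∀ p n, Y p n = Z p (τ n)) (t : ℝ) :
    ∫ ω, (X t ω - (μ[X t | sampleSigma Y]) ω) ^ 2 ∂μ
      = (∫ f, SX f) - ∫ f in band fb, gain SX Sη H fb t f := by
  have hfb : 0 < fb := Fact.out
  obtain ⟨hle, hge⟩ := mmse_eq_inf_risk h.source_int h.source_meas h.source_nonneg h.noise_meas
    h.noise_nonneg hX hη hXη h.response_meas h.response_fin hZ hτ hY rfl t
  set d := ∫ ω, (X t ω - (μ[X t | sampleSigma Y]) ω) ^ 2 ∂μ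
  have hd : 0 ≤ d := integral_nonneg fun _ => sq_nonneg _
  -- The error is below the risk of each truncated optimal symbol, and within any `ε` of the risk of
  -- some periodic symbol, which is at least the pointwise minimum.
  have heq : ENNReal.ofReal d
      = ∫⁻ f in band fb, ENNReal.ofReal (aliasSum SX fb f - gain SX Sη H fb t f) := by
    refine le_antisymm ?_ ?_
    · obtain ⟨φ, hφ, hφn, hlim⟩ := h.exists_tendsto_risk (fb := fb) t
      exact ge_of_tendsto' hlim fun n => hle (φ n) (hφ n) n (hφn n)
    · refine ENNReal.le_of_forall_pos_le_add fun ε hε _ => ?_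
      obtain ⟨φ, hφ, hr⟩ := hge ε hε
      refine (h.le_risk hφ t).trans (hr.trans ?_)
      rw [ENNReal.ofReal_add hd ε.coe_nonneg, ENNReal.ofReal_coe_nnreal]
  have hA := h.integrable_aliasSum hfb
  have hG := h.integrable_gain hfb t
  rw [← hA.2, ← integral_sub hA.1 hG, integral_eq_lintegral_of_nonneg_ae _
    (hA.1.sub' hG).aestronglyMeasurable, ← heq, ENNReal.toReal_ofReal hd]
  filter_upwards [h.ae_regular hfb] with f hf
  exact sub_nonneg.2 (hf.gain_nonneg_le h.source_nonneg h.noise_nonneg t).2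

lemma IsNoisyFilterOutput.measurable {G : ℝ → ℂ} {V : ℝ → Ω → ℝ}
    (hV : IsNoisyFilterOutput μ SX Sη X η G V) (t : ℝ) : Measurable (V t) := by
  obtain ⟨U, W, hU, hW, hUW⟩ := hV
  rw [show V t = U t + W t from funext (hUW t)]
  exact (hU t).1.add (hW t).1

/-- Fubini: product integrability follows from integrability in time of the mean-square error, since
the integrand is nonnegative. -/
lemma integral_normSqT_eq [IsFiniteMeasure μ]
    (hX_meas : Measurable (Function.uncurry X)) (hX : ∀ t, MemLp (X t) 2 μ)
    {Xt : ℝ → Ω → ℝ} (hXt_meas : Measurable (Function.uncurry Xt))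
    (hXt : ∀ t, Xt t =ᵐ[μ] μ[X t | m]) {T : ℝ} (hT : 0 ≤ T)
    (hint : IntervalIntegrable (fun t => ∫ ω, (X t ω - (μ[X t | m]) ω) ^ 2 ∂μ) volume (-T) T) :
    ∫ ω, normSqT T (fun t => X t ω - Xt t ω) ∂μ
      = (2 * T)⁻¹ * ∫ t in (-T)..T, ∫ ω, (X t ω - (μ[X t | m]) ω) ^ 2 ∂μ := by
  have hTT : -T ≤ T := by linarith
  have hsq : ∀ t, (fun ω => (X t ω - Xt t ω) ^ 2)
      =ᵐ[μ] fun ω => (X t ω - (μ[X t | m]) ω) ^ 2 := fun t => by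
    filter_upwards [hXt t] with ω hω
    rw [hω]
  have hprod : Integrable (Function.uncurry fun t ω => (X t ω - Xt t ω) ^ 2)
      ((volume.restrict (Set.Ioc (-T) T)).prod μ) := by
    refine (integrable_prod_iff ?_).2 ⟨ae_of_all _ fun t => ?_, ?_⟩
    · exact ((hX_meas.sub hXt_meas).pow_const 2).aestronglyMeasurable
    · exact (((hX t).sub ((hX t).condExp one_le_two)).integrable_sq).congr (hsq t).symm
    · refine ((intervalIntegrable_iff_integrableOn_Ioc_of_le hTT).1 hint).congr
        (ae_of_all _ fun t => ?_)
      simp only [Function.uncurry_apply_pair, norm_pow, Real.norm_eq_abs, sq_abs]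
      exact (integral_congr_ae (hsq t)).symm
  simp only [normSqT, integral_const_mul, intervalIntegral.integral_of_le hTT]
  rw [← integral_integral_swap hprod]
  congr 1
  exact integral_congr_ae (ae_of_all _ fun t => integral_congr_ae (hsq t))

end MeanSquareError

end SubNyquist

/-! ### The theorem. -/

theorem mainTheorem9 {Ω : Type*} [MeasurableSpace Ω] (μ : Measure Ω) [IsProbabilityMeasure μ]
    (P : ℕ) (hP : 0 < P) (fs : ℝ) (hfs : 0 < fs)
    (SX Sη : ℝ → ℝ)
    (hSX_int : Integrable SX) (hSX_meas : Measurable SX) (hSX_nonneg : ∀ f, 0 ≤ SX f)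
    (hSη_meas : Measurable Sη) (hSη_nonneg : ∀ f, 0 ≤ Sη f)
    (X : ℝ → Ω → ℝ) (η : SubNyquist.TestFunction Sη → Ω → ℝ)
    (hX : SubNyquist.IsStationaryGaussianProcess μ SX X)
    (hX_meas : Measurable (Function.uncurry X))
    (hη : SubNyquist.IsStationaryGaussianNoise μ Sη η)
    (hXη : IndepFun (fun ω t => X t ω) (fun ω φ => η φ ω) μ)
    (H : Fin P → ℝ → ℂ) (hH_meas : ∀ p, Measurable (H p))
    (hH_fin : ∀ p, Integrable fun f => (SX f + Sη f) * ‖H p f‖ ^ 2)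
    (Z : Fin P → ℝ → Ω → ℝ)
    (hZ : ∀ p, SubNyquist.IsNoisyFilterOutput μ SX Sη X η (H p) (Z p))
    (Y : Fin P → ℤ → Ω → ℝ)
    (hY : ∀ p n ω, Y p n ω = Z p (n * P / fs) ω) :
    IntervalIntegrable (SubNyquist.estimatorTrace SX Sη H (fs / P)) volume
      (-(fs / P / 2)) (fs / P / 2) ∧
    Tendsto
      (fun T : ℝ => (2 * T)⁻¹ * ∫ t in (-T)..T,
        ∫ ω, (X t ω - (μ[X t | SubNyquist.sampleSigma Y]) ω) ^ 2 ∂μ)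
      atTop
      (𝓝 ((∫ ω, X 0 ω ^ 2 ∂μ) -
        ∫ f in (-(fs / P / 2))..(fs / P / 2),
          SubNyquist.estimatorTrace SX Sη H (fs / P) f)) ∧
    ∀ Xt : ℝ → Ω → ℝ, SubNyquist.IsMMSEEstimator μ (SubNyquist.sampleSigma Y) X Xt →
      Tendsto
        (fun T : ℝ => ∫ ω, SubNyquist.normSqT T (fun t => X t ω - Xt t ω) ∂μ)
        atTop
        (𝓝 ((∫ ω, X 0 ω ^ 2 ∂μ) -
          ∫ f in (-(fs / P / 2))..(fs / P / 2),
            SubNyquist.estimatorTrace SX Sη H (fs / P) f)) := by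
  have hP' : (0 : ℝ) < P := Nat.cast_pos.2 hP
  have hfb : 0 < fs / P := div_pos hfs hP'
  have : Fact (0 < fs / P) := ⟨hfb⟩
  have hT0 : 0 < P / fs := div_pos hP' hfs
  have hT : P / fs * (fs / P) = 1 := by field_simp
  have hband : -(fs / P / 2) ≤ fs / P / 2 := by linarith
  have h : SubNyquist.Admissible SX Sη H :=
    ⟨hSX_int, hSX_meas, hSX_nonneg, hSη_meas, hSη_nonneg, hH_meas, hH_fin⟩
  have hd := h.integral_sq_sub_condExp (fb := fs / P) (τ := fun n => n * P / fs) hX hη hXη hZ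
    (fun n => by field_simp) (fun p n => funext (hY p n))
  obtain ⟨hgi, hg⟩ := h.integral_integral_gain hfb hT hT0
  have hper : Function.Periodic
      (fun t => ∫ ω, (X t ω - (μ[X t | SubNyquist.sampleSigma Y]) ω) ^ 2 ∂μ) (P / fs) := fun t => by
    simp only [hd]
    congr 2
    exact funext fun f => SubNyquist.gain_periodic hT f t
  have hint : IntervalIntegrable
      (fun t => ∫ ω, (X t ω - (μ[X t | SubNyquist.sampleSigma Y]) ω) ^ 2 ∂μ) volume 0 (P / fs) := by
    simp only [hd]
    exact intervalIntegrable_const.sub hgi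
  have hlim := SubNyquist.tendsto_mean_of_periodic hper hT0 hint
  have hval : (P / fs)⁻¹ * ∫ t in (0)..(P / fs),
        ∫ ω, (X t ω - (μ[X t | SubNyquist.sampleSigma Y]) ω) ^ 2 ∂μ
      = (∫ ω, X 0 ω ^ 2 ∂μ) - ∫ f in (-(fs / P / 2))..(fs / P / 2),
          SubNyquist.estimatorTrace SX Sη H (fs / P) f := by
    simp only [hd]
    rw [intervalIntegral.integral_sub intervalIntegrable_const hgi, hg,
      intervalIntegral.integral_const, hX.integral_sq 0, intervalIntegral.integral_of_le hband,
      smul_eq_mul, sub_zero, ← mul_sub, inv_mul_cancel_left₀ hT0.ne']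
  rw [hval] at hlim
  refine ⟨(intervalIntegrable_iff_integrableOn_Ioc_of_le hband).2 (h.integrable_estimatorTrace hfb),
    hlim, fun Xt hXt => hlim.congr' ?_⟩
  -- In `IsMMSEEstimator` joint measurability refers to the sample σ-algebra on `Ω`; this inclusion
  -- passes it to the ambient one.
  have hm : SubNyquist.sampleSigma Y ≤ ‹MeasurableSpace Ω› := iSup₂_le fun p n => by
    rw [show Y p n = Z p (n * P / fs) from funext (hY p n)]
    exact ((hZ p).measurable _).comap_le
  have hXt_meas : Measurable (Function.uncurry Xt) :=
    hXt.1.mono (sup_le_sup le_rfl (MeasurableSpace.comap_mono hm)) le_rfl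
  filter_upwards [eventually_ge_atTop 0] with T hT
  exact (SubNyquist.integral_normSqT_eq hX_meas hX.memLp hXt_meas hXt.2 hT
    (hper.intervalIntegrable₀ hT0.ne' hint _ _)).symm
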